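/- Let $p \ge 29$ be a prime, let $\chi$ be an even Dirichlet character modulo $p$ and let $k \ge 16$ be an even integer. Write $e(z)=e^{2\pi i z}$. There exist a real number $\sigma>0$ and two complex sequences $(a_m)_{m\ge 1}$, $(b_m)_{m\ge 1}$ with $|a_m|,|b_m| = O(m^{\sigma})$ such that the following two properties hold. (i) Neither of the functions $f(z)=\sum_{m\ge1} a_m e(mz)$ and $g(z)=\sum_{m\ge 1} b_m e(mz)$ on the upper half-plane belongs to $\bigcup_{l,N} S_l(\Gamma(N))$; that is, neither is a classical cusp form of any weight $l\in\mathbb{Z}$ for any principal congruence subgroup $\Gamma(N)$, $N\ge1$. (ii) For a primitive Dirichlet character $\psi$ modulo $q$ with $(q,p)=1$ put, for $\Re(s)>\sigma+1$, $$\Lambda(f,\psi,s)=(2\pi)^{-s}\Gamma(s)\sum_{m\ge1}a_m\psi(m)m^{-s},\qquad \Lambda(g,\psi,s)=(2\pi)^{-s}\Gamma(s)\sum_{m\ge1}b_m\psi(m)m^{-s}.$$ For every $q\ge 1$ with $(q,p)=1$ and every such $\psi$, both $\Lambda(f,\psi,s)$ and $\Lambda(g,\psi,s)$ continue holomorphically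 to the whole complex plane and are bounded in every vertical strip $x_1\le\Re(s)\le x_2$. Moreover, if $q\le\sqrt{(p-24)/3}$, then for all $s\in\mathbb{C}$ $$\Lambda(f,\psi,s)= i^k\,\chi(q)\,\psi(p)\,\frac{\tau(\psi)^2}{q}\,(pq^2)^{\frac{k}{2}-s}\,\Lambda(g,\overline{\psi},k-s),$$ where $\tau(\psi)=\sum_{c \bmod q}\psi(c)e(c/q)$ is the Gauss sum of $\psi$. -/

import Mathlib

open scoped MatrixGroups

noncomputable section

/-- The `q`-series `z ↦ ∑_{m ≥ 1} a_m e(mz)` on the upper half-plane, `e(z) = exp (2 π i z)`.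
The value `a 0` plays no role. -/
def qSeries (a : ℕ → ℂ) : UpperHalfPlane → ℂ := fun z =>
  ∑' m : ℕ+, a (m : ℕ) * Complex.exp (2 * Real.pi * Complex.I * (m : ℂ) * (z : ℂ))

/-- `h` is a classical cusp form of some integral weight `l` for some principal congruence
subgroup `Γ(N)` with `N ≥ 1`. -/
def IsClassicalCuspForm (h : UpperHalfPlane → ℂ) : Prop :=
  ∃ (l : ℤ) (N : ℕ), 0 < N ∧
    ∃ F : CuspForm ((CongruenceSubgroup.Gamma N : Subgroup SL(2, ℤ)) : Subgroup (GL (Fin 2) ℝ)) l,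
      ∀ z, F z = h z

/-- The completed twisted `L`-function
`(2 π)^{-s} Γ(s) ∑_{m ≥ 1} a_m ψ(m) m^{-s}`, meaningful where the series converges
(`LSeries` ignores the term with index `0`). -/
def twistedLambda (a : ℕ → ℂ) {q : ℕ} (ψ : DirichletCharacter ℂ q) (s : ℂ) : ℂ :=
  (2 * Real.pi : ℂ) ^ (-s) * Complex.Gamma s * LSeries (fun m : ℕ => a m * ψ (m : ZMod q)) s

/-- `F` is an entire function that agrees with `L` on the half-plane `re s > c`. -/
def IsEntireContinuation (F L : ℂ → ℂ) (c : ℝ) : Prop :=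
  Differentiable ℂ F ∧ ∀ s : ℂ, c < s.re → F s = L s

/-- `F` is bounded in every vertical strip `x₁ ≤ re s ≤ x₂`. -/
def BoundedInVerticalStrips (F : ℂ → ℂ) : Prop :=
  ∀ x₁ x₂ : ℝ, ∃ C : ℝ, ∀ s : ℂ, x₁ ≤ s.re → s.re ≤ x₂ → ‖F s‖ ≤ C

end

/-!
For `k = 12 + 2 n`, the form `f` is the product of the discriminant `Δ` with an Eisenstein series
of weight `2 n` and character `χ` for a subgroup `H` of infinite index in `Γ₀(p)`
(`smallSubgroup p`), and `g` is its transform under the Fricke involution `z ↦ -1 / (p z)`.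
The subgroup `H` is generated by `-1` and the elements of `Γ₀(p)` whose lower right entry `d`
satisfies `1 ≤ d` and `3 d² ≤ p - 24`. The Eisenstein series is the sum of
`χ(d)⁻¹ (c z + d)^{-2 n}` over the bottom rows `(c, d)` of elements of `H`, so that it is part of
an absolutely convergent series although `H` has infinite index; and as `Δ` decays exponentially
at every cusp, so does `f`.

*Analytic continuation.* Exponential decay at all rational points with denominator prime to `p`
is all that Mellin transforms need in order to be entire and bounded in vertical strips
(`IsRapidOnRay.boundedInVerticalStrips_mellin`), and a twist by a primitive character modulo `q`
is a combination of translates by `u / q` (`IsRapid.hasSum_twistRay`). No modularity is used here,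
which is why the continuation holds for every `q` prime to `p`.

*Functional equations.* The functional equation of a twist by a character modulo `q` needs the
transformation law only under elements of `Γ₀(p)` with lower right entry `q`
(`smallCuspForm_twist_relation`). These belong to `H` by definition as soon as `3 q² ≤ p - 24`,
which is the assumption `q ≤ √((p - 24) / 3)`.

*Failure of modularity.* If `f` were modular for `Γ(N)`, comparison of the automorphy factors
under a unipotent element shows that the weight would be `k`, so the Eisenstein factor would be
invariant under `Γ(N)`. Its constant term is `2`, while the constant term of its transform under
an element outside `H` is `0`; hence `Γ(N) ≤ H` (`smallCuspForm_not_invariant`). That is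
impossible by a dimension count (`not_Gamma_le_smallSubgroup`). On the one hand, `PSL(2, ℤ)` is
the free product of cyclic groups of orders `2` and `3`, so cocycles may be prescribed on the two
generators; for the action on the projective line over `ZMod p`, this gives a homomorphism
from `Γ₀(p)` to a rational vector space whose image spans a space of dimension at least
`(p - 7) / 6` (`exists_gamma0_hom`). On the other hand, `H` is generated by `-1`, two unipotent
elements and at most one element for each pair `1 ≤ u < q ≤ Q`, with `Q = ⌊√((p - 24) / 3)⌋`, so its
image spans a space of dimension at most `2 + Q (Q - 1) / 2 < (p - 7) / 6`. As every element of
`Γ₀(p)` has a power in `Γ(N)`, the two spans would agree if `Γ(N) ≤ H`.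
-/

noncomputable section

open Monoid ModularGroup UpperHalfPlane CongruenceSubgroup

/-! ### `PSL(2, ℤ)` as a free product -/

/-- The homomorphism from the cyclic group of order `n` that sends the generator to `x`. -/
def cyclicHom {P : Type*} [Group P] (n : ℕ) (x : P) (h : x ^ n = 1) :
    Multiplicative (ZMod n) →* P :=
  AddMonoidHom.toMultiplicativeLeft
    (ZMod.lift n ⟨zmultiplesHom (Additive P) (Additive.ofMul x), by
      simp [← ofMul_pow, h]⟩)

lemma cyclicHom_ofAdd_intCast {P : Type*} [Group P] (n : ℕ) (x : P) (h : x ^ n = 1) (m : ℤ) :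
    cyclicHom n x h (Multiplicative.ofAdd (m : ZMod n)) = x ^ m := by
  change Additive.toMul (ZMod.lift n _ (m : ZMod n)) = x ^ m
  rw [ZMod.lift_coe]
  rfl

lemma cyclicHom_ofAdd_one {P : Type*} [Group P] (n : ℕ) (x : P) (h : x ^ n = 1) :
    cyclicHom n x h (Multiplicative.ofAdd 1) = x := by
  simpa using cyclicHom_ofAdd_intCast n x h 1

/-- The orders of the two free factors of `PSL(2, ℤ)`. -/
def factorOrder (i : Bool) : ℕ := cond i 3 2

lemma S_sq_eq_neg_one : (S ^ 2 : SL(2, ℤ)) = -1 := by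
  decide

lemma TS_cube_eq_neg_one : ((T * S) ^ 3 : SL(2, ℤ)) = -1 := by
  decide

/-- `SL(2, ℤ)` acting on the upper half-plane by permutations; its image is `PSL(2, ℤ)`. -/
def moebiusPerm : SL(2, ℤ) →* Equiv.Perm ℍ := MulAction.toPermHom SL(2, ℤ) ℍ

lemma moebiusPerm_neg_one : moebiusPerm (-1) = 1 := by
  ext1 z
  simp [moebiusPerm]

/-- The two generators of orders `2` and `3` of `PSL(2, ℤ)`, written in `SL(2, ℤ)`. -/
def factorGen (i : Bool) : SL(2, ℤ) := cond i (T * S) S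

lemma moebiusPerm_factorGen_pow (i : Bool) :
    moebiusPerm (factorGen i) ^ factorOrder i = 1 := by
  rw [← map_pow, ← moebiusPerm_neg_one]
  cases i
  · exact congrArg _ S_sq_eq_neg_one
  · exact congrArg _ TS_cube_eq_neg_one

lemma coe_S_smul (z : ℍ) : ((S • z : ℍ) : ℂ) = (-(z : ℂ))⁻¹ := by
  rw [modular_S_smul]

lemma coe_TS_smul (z : ℍ) : (((T * S) • z : ℍ) : ℂ) = 1 + (-(z : ℂ))⁻¹ := by
  rw [mul_smul, modular_T_smul, coe_vadd, coe_S_smul]; simp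

lemma re_S_smul (z : ℍ) : (S • z).re = -z.re / Complex.normSq z := by
  rw [← coe_re, coe_S_smul, Complex.inv_re]; simp

lemma re_TS_smul (z : ℍ) : ((T * S) • z).re = 1 + -z.re / Complex.normSq z := by
  rw [← coe_re, coe_TS_smul, Complex.add_re, Complex.inv_re]; simp

/-- The half-planes on which the ping-pong argument is played: each nontrivial power of the
generator of order `3` moves `re < 0` into `re > 0`, and `S` moves `re > 0` into `re < 0`. -/
def pingPongSet (i : Bool) : Set ℍ := cond i {z | 0 < z.re} {z | z.re < 0}

lemma S_smul_mem_pingPongSet {z : ℍ} (hz : 0 < z.re) : (S • z).re < 0 := by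
  rw [re_S_smul]
  exact div_neg_of_neg_of_pos (by linarith) z.normSq_pos

lemma TS_smul_mem_pingPongSet {z : ℍ} (hz : z.re < 0) : 0 < ((T * S) • z).re := by
  rw [re_TS_smul]
  have := div_pos (neg_pos.2 hz) z.normSq_pos
  linarith

lemma TS_sq_smul_mem_pingPongSet {z : ℍ} (hz : z.re < 0) :
    0 < ((T * S) • (T * S) • z).re := by
  have h : (((T * S) • (T * S) • z : ℍ) : ℂ) = (1 - (z : ℂ))⁻¹ := by
    rw [coe_TS_smul, coe_TS_smul]
    have h0 : (z : ℂ) ≠ 0 := z.ne_zero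
    have h1 : (1 : ℂ) - z ≠ 0 := by
      intro h
      have := congrArg Complex.im h
      simp [z.im_ne_zero] at this
    have h2 : -(1 + (-(z : ℂ))⁻¹) = (1 - z) / z := by field_simp; ring
    rw [h2, inv_div]
    field_simp
    ring
  rw [← coe_re, h, Complex.inv_re]
  refine div_pos ?_ (Complex.normSq_pos.2 ?_)
  · simp; linarith
  · intro h
    have := congrArg Complex.im h
    simp [z.im_ne_zero] at this

/-- `PSL(2, ℤ)` is the free product of the groups generated by `S` and `T * S`. -/
lemma lift_cyclicHom_injective :
    Function.Injective (CoprodI.lift fun i : Bool =>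
      cyclicHom (factorOrder i) (moebiusPerm (factorGen i)) (moebiusPerm_factorGen_pow i)) := by
  refine CoprodI.lift_injective_of_ping_pong _ (Or.inr ⟨true, ?_⟩) pingPongSet ?_ ?_ ?_
  · change 3 ≤ Cardinal.mk (ZMod 3)
    simp
  · rintro (_ | _)
    · exact ⟨⟨-1 + Complex.I, by simp⟩, by change (-1 + Complex.I).re < 0; simp⟩
    · exact ⟨⟨1 + Complex.I, by simp⟩, by change 0 < (1 + Complex.I).re; simp⟩
  · rintro (_ | _) (_ | _) h
    · exact absurd rfl h
    · refine Set.disjoint_left.2 fun z (h1 : z.re < 0) (h2 : 0 < z.re) => by linarith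
    · refine Set.disjoint_left.2 fun z (h2 : 0 < z.re) (h1 : z.re < 0) => by linarith
    · exact absurd rfl h
  · rintro (_ | _) (_ | _) h x hx
    · exact absurd rfl h
    · have : x = Multiplicative.ofAdd (1 : ZMod 2) := by
        revert x; change ∀ x : ZMod 2, x ≠ 0 → x = 1; decide
      subst this
      have := cyclicHom_ofAdd_one (factorOrder false) _ (moebiusPerm_factorGen_pow false)
      rintro _ ⟨z, hz, rfl⟩
      dsimp only
      erw [this]
      exact S_smul_mem_pingPongSet hz
    · have : x = Multiplicative.ofAdd (1 : ZMod 3) ∨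
          x = Multiplicative.ofAdd (1 : ZMod 3) * Multiplicative.ofAdd (1 : ZMod 3) := by
        revert x; change ∀ x : ZMod 3, x ≠ 0 → x = 1 ∨ x = 1 + 1; decide
      have h1 := cyclicHom_ofAdd_one (factorOrder true) _ (moebiusPerm_factorGen_pow true)
      rintro _ ⟨z, hz, rfl⟩
      dsimp only
      rcases this with rfl | rfl
      · erw [h1]
        exact TS_smul_mem_pingPongSet hz
      · erw [map_mul, h1]
        exact TS_sq_smul_mem_pingPongSet hz
    · exact absurd rfl h

/-- The universal property of `PSL(2, ℤ)` as a free product of cyclic groups of orders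
`2` and `3`. -/
theorem exists_hom_of_relations {P : Type*} [Group P] (s u : P) (hs : s ^ 2 = 1)
    (hu : u ^ 3 = 1) : ∃ Φ : SL(2, ℤ) →* P, Φ S = s ∧ Φ (T * S) = u := by
  set ι := CoprodI.lift fun i : Bool =>
      cyclicHom (factorOrder i) (moebiusPerm (factorGen i)) (moebiusPerm_factorGen_pow i) with hι
  have hgen (i : Bool) : ι (CoprodI.of (i := i) (Multiplicative.ofAdd 1)) =
      moebiusPerm (factorGen i) := by
    rw [hι, CoprodI.lift_of, cyclicHom_ofAdd_one]
  have hrange (γ : SL(2, ℤ)) : moebiusPerm γ ∈ ι.range := by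
    have : (⊤ : Subgroup SL(2, ℤ)) ≤ ι.range.comap moebiusPerm := by
      rw [← SpecialLinearGroup.SL2Z_generators, Subgroup.closure_le]
      have hS : S ∈ ι.range.comap moebiusPerm := ⟨_, hgen false⟩
      have hU : T * S ∈ ι.range.comap moebiusPerm := ⟨_, hgen true⟩
      rintro x (rfl | rfl)
      · exact hS
      · simpa using Subgroup.mul_mem _ hU (Subgroup.inv_mem _ hS)
    exact this (Subgroup.mem_top γ)
  let e := MonoidHom.ofInjective (f := ι) lift_cyclicHom_injective
  let ψ : CoprodI (fun i : Bool => Multiplicative (ZMod (factorOrder i))) →* P :=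
    CoprodI.lift fun i => match i with
      | false => cyclicHom 2 s hs
      | true => cyclicHom 3 u hu
  refine ⟨ψ.comp (e.symm.toMonoidHom.comp (moebiusPerm.codRestrict _ hrange)), ?_, ?_⟩
  · have : e.symm (moebiusPerm.codRestrict _ hrange S) =
        CoprodI.of (i := false) (Multiplicative.ofAdd 1) := by
      rw [MulEquiv.symm_apply_eq]
      exact Subtype.ext (hgen false).symm
    change ψ (e.symm (moebiusPerm.codRestrict _ hrange S)) = s
    rw [this]
    simp only [ψ, CoprodI.lift_of]
    exact cyclicHom_ofAdd_one 2 s hs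
  · have : e.symm (moebiusPerm.codRestrict _ hrange (T * S)) =
        CoprodI.of (i := true) (Multiplicative.ofAdd 1) := by
      rw [MulEquiv.symm_apply_eq]
      exact Subtype.ext (hgen true).symm
    change ψ (e.symm (moebiusPerm.codRestrict _ hrange (T * S))) = u
    rw [this]
    simp only [ψ, CoprodI.lift_of]
    exact cyclicHom_ofAdd_one 3 u hu

/-! ### Cocycles for `SL(2, ℤ)` -/

section Cocycle

variable {X M : Type*} [AddCommGroup M]

/-- A permutation of `X × M` lies over the permutation `σ` of `X` if it acts on each fibre as a
translation. -/
def IsFibreTranslation (Θ : Equiv.Perm (X × M)) (σ : Equiv.Perm X) : Prop :=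
  ∃ d : X → M, ∀ x t, Θ (x, t) = (σ x, t + d x)

lemma IsFibreTranslation.mul {Θ Θ' : Equiv.Perm (X × M)} {σ σ' : Equiv.Perm X}
    (h : IsFibreTranslation Θ σ) (h' : IsFibreTranslation Θ' σ') :
    IsFibreTranslation (Θ * Θ') (σ * σ') := by
  obtain ⟨d, hd⟩ := h
  obtain ⟨d', hd'⟩ := h'
  exact ⟨fun x => d' x + d (σ' x), fun x t => by simp [hd, hd', add_assoc]⟩

lemma IsFibreTranslation.inv {Θ : Equiv.Perm (X × M)} {σ : Equiv.Perm X}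
    (h : IsFibreTranslation Θ σ) : IsFibreTranslation Θ⁻¹ σ⁻¹ := by
  obtain ⟨d, hd⟩ := h
  exact ⟨fun x => -d (σ⁻¹ x), fun x t => by rw [Equiv.Perm.inv_eq_iff_eq, hd]; simp⟩

/-- Since `PSL(2, ℤ)` is a free product of cyclic groups of orders `2` and `3`, a cocycle may be
prescribed on the two generators, subject only to one relation for each of them. -/
theorem exists_cocycle_of_relations (α : SL(2, ℤ) →* Equiv.Perm X) (hα : α (-1) = 1)
    (a b : X → M) (ha : ∀ x, a x + a (α S x) = 0)
    (hb : ∀ x, b x + b (α (T * S) x) + b (α (T * S) (α (T * S) x)) = 0) :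
    ∃ c : SL(2, ℤ) → X → M, (∀ γ γ' x, c (γ * γ') x = c γ' x + c γ (α γ' x)) ∧
      c S = a ∧ c (T * S) = b := by
  let s : Equiv.Perm (X × M) := Equiv.prodShear (α S) fun x => Equiv.addRight (a x)
  let u : Equiv.Perm (X × M) := Equiv.prodShear (α (T * S)) fun x => Equiv.addRight (b x)
  have hαS (x : X) : α S (α S x) = x := by
    rw [← Equiv.Perm.mul_apply, ← map_mul, ← pow_two, S_sq_eq_neg_one, hα, Equiv.Perm.one_apply]
  have hαU (x : X) : α (T * S) (α (T * S) (α (T * S) x)) = x := by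
    have : α ((T * S) ^ 3) = 1 := by rw [TS_cube_eq_neg_one, hα]
    rw [map_pow, pow_succ, pow_two] at this
    exact congrArg (· x) this
  obtain ⟨Φ, hΦS, hΦU⟩ := exists_hom_of_relations s u
    (by
      ext1 ⟨x, t⟩
      refine Prod.ext (hαS x) ?_
      change t + a x + a (α S x) = t
      rw [add_assoc, ha, add_zero])
    (by
      rw [pow_succ, pow_two]
      ext1 ⟨x, t⟩
      refine Prod.ext (hαU x) ?_
      change t + b x + b (α (T * S) x) + b (α (T * S) (α (T * S) x)) = t
      rw [add_assoc, add_assoc, ← add_assoc (b x), hb, add_zero])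
  have key (γ : SL(2, ℤ)) : IsFibreTranslation (Φ γ) (α γ) := by
    have hS : IsFibreTranslation (Φ S) (α S) := ⟨a, fun x t => by rw [hΦS]; rfl⟩
    have hU : IsFibreTranslation (Φ (T * S)) (α (T * S)) := ⟨b, fun x t => by rw [hΦU]; rfl⟩
    have hγ : γ ∈ Subgroup.closure {S, T} := by simp [SpecialLinearGroup.SL2Z_generators]
    induction hγ using Subgroup.closure_induction with
    | mem x hx =>
      rcases hx with rfl | rfl
      · exact hS
      · simpa using hU.mul hS.inv
    | one => exact ⟨0, fun x t => by simp⟩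
    | mul x y _ _ hx hy => simpa only [map_mul] using hx.mul hy
    | inv x _ hx => simpa only [map_inv] using hx.inv
  choose c hc using key
  refine ⟨c, fun γ γ' x => ?_, ?_, ?_⟩
  · have h := hc (γ * γ') x 0
    rw [map_mul, Equiv.Perm.mul_apply, hc, hc] at h
    simpa using (congrArg Prod.snd h).symm
  · ext1 x
    have h := hc S x 0
    rw [hΦS] at h
    simpa [s] using (congrArg Prod.snd h).symm
  · ext1 x
    have h := hc (T * S) x 0
    rw [hΦU] at h
    simpa [u] using (congrArg Prod.snd h).symm

end Cocycle

section OrbitCount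

open Finset

/-- Every value of a `σ`-invariant function is taken at a fixed point of `σ` or at least twice. -/
lemma two_mul_card_image_le {X Y : Type*} [Fintype X] [DecidableEq X] [DecidableEq Y]
    (σ : X → X) (f : X → Y) (hf : ∀ x, f (σ x) = f x) :
    2 * (univ.image f).card ≤ Fintype.card X + #{x | σ x = x} := by
  have h : ∀ y ∈ univ.image f, 2 ≤ ∑ x with f x = y, (1 + if σ x = x then 1 else 0) := by
    intro y hy
    obtain ⟨x, -, rfl⟩ := mem_image.1 hy
    by_cases hx : σ x = x
    · refine le_trans ?_ (single_le_sum (fun _ _ => Nat.zero_le _)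
        (mem_filter.2 ⟨mem_univ x, rfl⟩))
      simp [hx]
    · rw [sum_add_distrib]
      refine le_trans ?_ (Nat.le_add_right _ _)
      rw [← card_eq_sum_ones, ← card_pair (Ne.symm hx)]
      exact card_le_card (by intro z hz; aesop)
  calc 2 * (univ.image f).card = ∑ y ∈ univ.image f, 2 := by simp [mul_comm]
    _ ≤ ∑ y ∈ univ.image f, ∑ x with f x = y, (1 + if σ x = x then 1 else 0) := sum_le_sum h
    _ = ∑ x, (1 + if σ x = x then 1 else 0) :=
      sum_fiberwise_of_maps_to (fun x _ => mem_image_of_mem f (mem_univ x)) _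
    _ = _ := by rw [sum_add_distrib, card_filter]; simp

/-- Every value of a `σ`-invariant function is taken at a fixed point of `σ` or on a whole orbit
of length `3`. -/
lemma three_mul_card_image_le {X Y : Type*} [Fintype X] [DecidableEq X] [DecidableEq Y]
    (σ : X → X) (hσ : ∀ x, σ (σ (σ x)) = x) (f : X → Y) (hf : ∀ x, f (σ x) = f x) :
    3 * (univ.image f).card ≤ Fintype.card X + 2 * #{x | σ x = x} := by
  have h : ∀ y ∈ univ.image f, 3 ≤ ∑ x with f x = y, (1 + if σ x = x then 2 else 0) := by
    intro y hy
    obtain ⟨x, -, rfl⟩ := mem_image.1 hy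
    by_cases hx : σ x = x
    · refine le_trans ?_ (single_le_sum (fun _ _ => Nat.zero_le _)
        (mem_filter.2 ⟨mem_univ x, rfl⟩))
      simp [hx]
    · rw [sum_add_distrib]
      refine le_trans ?_ (Nat.le_add_right _ _)
      have h3 : #{x, σ x, σ (σ x)} = 3 := by
        refine card_eq_three.2 ⟨_, _, _, Ne.symm hx, fun h => hx ?_, fun h => hx ?_, rfl⟩
        · exact (congrArg σ h).trans (hσ x)
        · have := congrArg σ (congrArg σ h)
          rw [hσ] at this
          exact this.symm
      rw [← card_eq_sum_ones, ← h3]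
      exact card_le_card (by intro z hz; aesop)
  calc 3 * (univ.image f).card = ∑ y ∈ univ.image f, 3 := by simp [mul_comm]
    _ ≤ ∑ y ∈ univ.image f, ∑ x with f x = y, (1 + if σ x = x then 2 else 0) := sum_le_sum h
    _ = ∑ x, (1 + if σ x = x then 2 else 0) :=
      sum_fiberwise_of_maps_to (fun x _ => mem_image_of_mem f (mem_univ x)) _
    _ = _ := by rw [sum_add_distrib, card_filter, mul_sum]; simp

end OrbitCount

open Finset in
/-- The universal cocycle: the values on the two generators span a space whose dimension is
bounded below by counting the orbits of the generators. -/
theorem exists_universal_cocycle {X : Type} [Fintype X] [DecidableEq X]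
    (α : SL(2, ℤ) →* Equiv.Perm X) (hα : α (-1) = 1) :
    ∃ (M : Type) (_ : AddCommGroup M) (_ : Module ℚ M) (_ : FiniteDimensional ℚ M)
      (c : SL(2, ℤ) → X → M), (∀ γ γ' x, c (γ * γ') x = c γ' x + c γ (α γ' x)) ∧
      Submodule.span ℚ (Set.range (c S) ∪ Set.range (c (T * S))) = ⊤ ∧
      7 * Fintype.card X ≤ 6 * Module.finrank ℚ M + 3 * #{x | α S x = x} +
        4 * #{x | α (T * S) x = x} := by
  classical
  let e₁ (x : X) : X ⊕ X →₀ ℚ := Finsupp.single (Sum.inl x) 1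
  let e₂ (x : X) : X ⊕ X →₀ ℚ := Finsupp.single (Sum.inr x) 1
  let r₁ (x : X) := e₁ x + e₁ (α S x)
  let r₂ (x : X) := e₂ x + e₂ (α (T * S) x) + e₂ (α (T * S) (α (T * S) x))
  have hαS (x : X) : α S (α S x) = x := by
    rw [← Equiv.Perm.mul_apply, ← map_mul, ← pow_two, S_sq_eq_neg_one, hα, Equiv.Perm.one_apply]
  have hαU (x : X) : α (T * S) (α (T * S) (α (T * S) x)) = x := by
    have : α ((T * S) ^ 3) = 1 := by rw [TS_cube_eq_neg_one, hα]
    rw [map_pow, pow_succ, pow_two] at this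
    exact congrArg (· x) this
  let I : Finset (X ⊕ X →₀ ℚ) := univ.image r₁ ∪ univ.image r₂
  let R : Submodule ℚ (X ⊕ X →₀ ℚ) := Submodule.span ℚ I
  have hr₁ (x : X) : r₁ x ∈ R := Submodule.subset_span (by simp [I])
  have hr₂ (x : X) : r₂ x ∈ R := Submodule.subset_span (by simp [I])
  obtain ⟨c, hc, hcS, hcU⟩ := exists_cocycle_of_relations α hα (fun x => R.mkQ (e₁ x))
    (fun x => R.mkQ (e₂ x))
    (fun x => by
      rw [← map_add, Submodule.mkQ_apply, Submodule.Quotient.mk_eq_zero]; exact hr₁ x)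
    (fun x => by
      rw [← map_add, ← map_add, Submodule.mkQ_apply, Submodule.Quotient.mk_eq_zero]; exact hr₂ x)
  refine ⟨_ ⧸ R, inferInstance, inferInstance, inferInstance, c, hc, ?_, ?_⟩
  · rw [eq_top_iff]
    intro m _
    obtain ⟨v, rfl⟩ := R.mkQ_surjective m
    induction v using Finsupp.induction_linear with
    | zero => simp
    | add v w hv hw => rw [map_add]; exact add_mem (hv trivial) (hw trivial)
    | single i t =>
      have : Finsupp.single i t = t • Finsupp.single i (1 : ℚ) := by simp
      rw [this, map_smul]
      refine Submodule.smul_mem _ _ (Submodule.subset_span ?_)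
      rcases i with x | x
      · exact Or.inl ⟨x, by rw [hcS]⟩
      · exact Or.inr ⟨x, by rw [hcU]⟩
  · have h1 : Module.finrank ℚ R ≤ I.card := finrank_span_finset_le_card I
    have h2 : I.card ≤ _ := card_union_le _ _
    have h3 := two_mul_card_image_le (α S) r₁ (fun x => by
      simp only [r₁, hαS]; exact add_comm _ _)
    have h4 := three_mul_card_image_le (α (T * S)) hαU r₂ (fun x => by
      simp only [r₂, hαU]; abel)
    have h5 := R.finrank_quotient_add_finrank
    rw [Module.finrank_finsupp_self, Fintype.card_sum] at h5
    omega

/-! ### A homomorphism from `Γ₀(p)` to a vector space -/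

section ProjectiveLine

variable (p : ℕ) [Fact p.Prime]

/-- `SL(2, ℤ)` acting on the projective line over `ZMod p`. -/
def projLineHom : SL(2, ℤ) →* Equiv.Perm (OnePoint (ZMod p)) :=
  (MulAction.toPermHom (GL (Fin 2) (ZMod p)) (OnePoint (ZMod p))).comp
    (Matrix.SpecialLinearGroup.toGL.comp (Matrix.SpecialLinearGroup.map (Int.castRingHom (ZMod p))))

variable {p}

instance : DecidableEq (OnePoint (ZMod p)) := inferInstanceAs (DecidableEq (Option (ZMod p)))

lemma projLineHom_infty (γ : SL(2, ℤ)) : projLineHom p γ OnePoint.infty =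
    if ((γ 1 0 : ℤ) : ZMod p) = 0 then OnePoint.infty
    else (((γ 0 0 : ℤ) : ZMod p) / ((γ 1 0 : ℤ) : ZMod p) : ZMod p) := by
  change Matrix.SpecialLinearGroup.toGL
    (Matrix.SpecialLinearGroup.map (Int.castRingHom (ZMod p)) γ) •
      (OnePoint.infty : OnePoint (ZMod p)) = _
  rw [OnePoint.smul_infty_eq_ite]
  simp
  rfl

lemma projLineHom_coe (γ : SL(2, ℤ)) (x : ZMod p) : projLineHom p γ x =
    if ((γ 1 0 : ℤ) : ZMod p) * x + ((γ 1 1 : ℤ) : ZMod p) = 0 then OnePoint.infty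
    else ((((γ 0 0 : ℤ) : ZMod p) * x + ((γ 0 1 : ℤ) : ZMod p)) /
      (((γ 1 0 : ℤ) : ZMod p) * x + ((γ 1 1 : ℤ) : ZMod p)) : ZMod p) := by
  change Matrix.SpecialLinearGroup.toGL
    (Matrix.SpecialLinearGroup.map (Int.castRingHom (ZMod p)) γ) • (x : OnePoint (ZMod p)) = _
  rw [OnePoint.smul_some_eq_ite]
  simp
  rfl

lemma projLineHom_neg_one : projLineHom p (-1) = 1 := by
  ext1 x
  induction x using OnePoint.rec with
  | infty => rw [projLineHom_infty]; simp
  | coe x => rw [projLineHom_coe]; simp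

lemma projLineHom_infty_eq_iff (γ : SL(2, ℤ)) :
    projLineHom p γ OnePoint.infty = OnePoint.infty ↔ γ ∈ Gamma0 p := by
  rw [projLineHom_infty, Gamma0_mem]
  simp

lemma TzpowS_infty (m : ℤ) :
    projLineHom p (T ^ m * S) OnePoint.infty = ((m : ZMod p) : ZMod p) := by
  have h : ((T ^ m * S : SL(2, ℤ)) : Matrix (Fin 2) (Fin 2) ℤ) = !![m, -1; 1, 0] := by
    rw [Matrix.SpecialLinearGroup.coe_mul, coe_T_zpow, coe_S]
    simp
  rw [projLineHom_infty]
  have h0 : (T ^ m * S : SL(2, ℤ)) 0 0 = m := congrFun (congrFun h 0) 0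
  have h1 : (T ^ m * S : SL(2, ℤ)) 1 0 = 1 := congrFun (congrFun h 1) 0
  simp [h0, h1]

open Finset

lemma card_roots_quadratic_le (b c : ZMod p) : #{x : ZMod p | x ^ 2 + b * x + c = 0} ≤ 2 := by
  let f : Polynomial (ZMod p) := .X ^ 2 + .C b * .X + .C c
  have hd : f.natDegree = 2 := by
    simp only [f]; compute_degree!
  have hf : f ≠ 0 := by rintro h; rw [h] at hd; simp at hd
  calc #{x : ZMod p | x ^ 2 + b * x + c = 0} ≤ #f.roots.toFinset := by
        refine card_le_card fun x hx => ?_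
        rw [Multiset.mem_toFinset, Polynomial.mem_roots hf]
        simpa [f] using hx
    _ ≤ f.roots.card := Multiset.toFinset_card_le _
    _ ≤ 2 := hd ▸ f.card_roots'

/-- The fixed points solve `x² + 1 = 0`. -/
lemma card_fixed_S_le : #{x | projLineHom p S x = x} ≤ 2 := by
  refine le_trans (card_le_card (t := ({x : ZMod p | x ^ 2 + 0 * x + 1 = 0} : Finset _).map
    ⟨((↑) : ZMod p → OnePoint (ZMod p)), OnePoint.coe_injective⟩) fun x hx => ?_)
    (by rw [card_map]; exact card_roots_quadratic_le 0 1)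
  simp only [mem_filter, mem_univ, true_and] at hx
  induction x using OnePoint.rec with
  | infty => rw [projLineHom_infty] at hx; simp [S] at hx
  | coe x =>
    rw [projLineHom_coe] at hx
    by_cases h0 : x = 0
    · simp [S, h0] at hx
    · have hx : -1 / x = x := by simpa [S, h0] using hx
      refine mem_map.2 ⟨x, ?_, rfl⟩
      rw [div_eq_iff h0] at hx
      simp only [mem_filter, mem_univ, true_and]
      linear_combination -hx

/-- The fixed points solve `x² - x + 1 = 0`. -/
lemma card_fixed_TS_le : #{x | projLineHom p (T * S) x = x} ≤ 2 := by
  have h : ((T * S : SL(2, ℤ)) : Matrix (Fin 2) (Fin 2) ℤ) = !![1, -1; 1, 0] := by decide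
  refine le_trans (card_le_card (t := ({x : ZMod p | x ^ 2 + (-1) * x + 1 = 0} : Finset _).map
    ⟨((↑) : ZMod p → OnePoint (ZMod p)), OnePoint.coe_injective⟩) fun x hx => ?_)
    (by rw [card_map]; exact card_roots_quadratic_le (-1) 1)
  simp only [mem_filter, mem_univ, true_and] at hx
  have h00 : (T * S : SL(2, ℤ)) 0 0 = 1 := congrFun (congrFun h 0) 0
  have h01 : (T * S : SL(2, ℤ)) 0 1 = -1 := congrFun (congrFun h 0) 1
  have h10 : (T * S : SL(2, ℤ)) 1 0 = 1 := congrFun (congrFun h 1) 0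
  have h11 : (T * S : SL(2, ℤ)) 1 1 = 0 := congrFun (congrFun h 1) 1
  induction x using OnePoint.rec with
  | infty => rw [projLineHom_infty, h00, h10] at hx; simp at hx
  | coe x =>
    rw [projLineHom_coe, h00, h01, h10, h11] at hx
    by_cases h0 : x = 0
    · simp [h0] at hx
    · have hx : (x + -1) / x = x := by simpa [h0] using hx
      refine mem_map.2 ⟨x, ?_, rfl⟩
      rw [div_eq_iff h0] at hx
      simp only [mem_filter, mem_univ, true_and]
      linear_combination -hx

end ProjectiveLine

/-- There is a homomorphism `φ`, trivial on `-1`, from `Γ₀(p)` to a rational vector space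
whose image spans a subspace of dimension at least `(p - 7) / 6`. -/
theorem exists_gamma0_hom (p : ℕ) [Fact p.Prime] :
    ∃ (M : Type) (_ : AddCommGroup M) (_ : Module ℚ M) (_ : FiniteDimensional ℚ M)
      (φ : Gamma0 p →* Multiplicative M),
      p ≤ 6 * Module.finrank ℚ
        (Submodule.span ℚ (Set.range fun γ => Multiplicative.toAdd (φ γ))) + 7 ∧
      ∀ γ : Gamma0 p, (γ : SL(2, ℤ)) = -1 → φ γ = 1 := by
  obtain ⟨M, _, _, _, c, hc, hspan, hdim⟩ :=
    exists_universal_cocycle (projLineHom p) projLineHom_neg_one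
  have hfix (γ : Gamma0 p) : projLineHom p γ OnePoint.infty = OnePoint.infty :=
    (projLineHom_infty_eq_iff _).2 γ.2
  have hc1 (x) : c 1 x = 0 := by simpa using hc 1 1 x
  let φ : Gamma0 p →* Multiplicative M :=
    { toFun γ := Multiplicative.ofAdd (c γ OnePoint.infty)
      map_one' := by simp [hc1]
      map_mul' γ γ' := by simp [hc, hfix, mul_comm] }
  refine ⟨M, inferInstance, inferInstance, inferInstance, φ, ?_, ?_⟩
  · set L := Submodule.span ℚ (Set.range fun γ => Multiplicative.toAdd (φ γ)) with hL
    let N := Submodule.span ℚ (Set.range fun n : ZMod p => c (T ^ n.valMinAbs * S) OnePoint.infty)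
    have hmem (γ : SL(2, ℤ)) (hγ : γ ∈ Gamma0 p) : c γ OnePoint.infty ∈ L :=
      Submodule.subset_span ⟨⟨γ, hγ⟩, rfl⟩
    -- coset representatives: elements moving `∞` to a given point
    have hrep (x : OnePoint (ZMod p)) :
        ∃ g, projLineHom p g OnePoint.infty = x ∧ c g OnePoint.infty ∈ N := by
      induction x using OnePoint.rec with
      | infty => exact ⟨1, by simp, by rw [hc1]; exact zero_mem _⟩
      | coe x =>
        exact ⟨T ^ x.valMinAbs * S, by rw [TzpowS_infty]; simp, Submodule.subset_span ⟨x, rfl⟩⟩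
    have hall (δ : SL(2, ℤ)) (x : OnePoint (ZMod p)) : c δ x ∈ L ⊔ N := by
      obtain ⟨g, hg, hgN⟩ := hrep x
      obtain ⟨g', hg', hgN'⟩ := hrep (projLineHom p δ x)
      have h0 : g'⁻¹ * (δ * g) ∈ Gamma0 p := by
        rw [← projLineHom_infty_eq_iff, map_mul, map_mul, Equiv.Perm.mul_apply,
          Equiv.Perm.mul_apply, hg, map_inv, Equiv.Perm.inv_eq_iff_eq, hg']
      have h1 := hc g' (g'⁻¹ * (δ * g)) OnePoint.infty
      rw [(projLineHom_infty_eq_iff _).2 h0, mul_inv_cancel_left, hc, hg] at h1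
      have h2 : c δ x = c (g'⁻¹ * (δ * g)) OnePoint.infty +
          (c g' OnePoint.infty - c g OnePoint.infty) := by
        rw [← add_sub_assoc, ← h1]; abel
      rw [h2]
      exact Submodule.add_mem_sup (hmem _ h0) (sub_mem hgN' hgN)
    have htop : L ⊔ N = ⊤ := by
      rw [eq_top_iff, ← hspan, Submodule.span_le]
      rintro _ (⟨x, rfl⟩ | ⟨x, rfl⟩)
      · exact hall _ _
      · exact hall _ _
    have h1 : Module.finrank ℚ M ≤ Module.finrank ℚ L + Module.finrank ℚ N := by
      rw [← finrank_top ℚ M, ← htop]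
      exact Submodule.finrank_add_le_finrank_add_finrank L N
    have h2 : Module.finrank ℚ N ≤ p := by
      refine (finrank_range_le_card (R := ℚ)
        (fun n : ZMod p => c (T ^ n.valMinAbs * S) OnePoint.infty)).trans ?_
      rw [ZMod.card]
    have h3 := card_fixed_S_le (p := p)
    have h4 := card_fixed_TS_le (p := p)
    have h5 : Fintype.card (OnePoint (ZMod p)) = p + 1 := by
      change Fintype.card (Option (ZMod p)) = p + 1
      rw [Fintype.card_option, ZMod.card]
    omega
  · rintro ⟨γ, hγ⟩ rfl
    have hT : Multiplicative.toAdd (φ ⟨-1, hγ⟩ * φ ⟨-1, hγ⟩) = 0 := by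
      rw [← map_mul]
      change c (-1 * -1) _ = 0
      simp [hc1]
    rw [toAdd_mul, ← two_smul ℚ] at hT
    exact (smul_eq_zero.1 hT).resolve_left two_ne_zero

/-! ### The subgroup generated by elements with small lower right entry -/

/-- The subgroup of `Γ₀(p)` generated by `-1` and the elements whose lower right entry `d` is
positive and at most `√((p - 24) / 3)`. -/
def smallSubgroup (p : ℕ) : Subgroup SL(2, ℤ) :=
  Subgroup.closure ({-1} ∪ {γ | γ ∈ Gamma0 p ∧ 1 ≤ γ 1 1 ∧ 3 * (γ 1 1) ^ 2 ≤ (p : ℤ) - 24})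

lemma smallSubgroup_le (p : ℕ) : smallSubgroup p ≤ Gamma0 p := by
  rw [smallSubgroup, Subgroup.closure_le]
  rintro γ (rfl | h)
  · rw [SetLike.mem_coe, Gamma0_mem]; simp
  · exact h.1

lemma neg_one_mem_smallSubgroup (p : ℕ) : -1 ∈ smallSubgroup p :=
  Subgroup.subset_closure (Or.inl rfl)

lemma mem_smallSubgroup {p : ℕ} {γ : SL(2, ℤ)} (h : γ ∈ Gamma0 p) (h1 : 1 ≤ γ 1 1)
    (h2 : 3 * (γ 1 1) ^ 2 ≤ (p : ℤ) - 24) : γ ∈ smallSubgroup p :=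
  Subgroup.subset_closure (Or.inr ⟨h, h1, h2⟩)

/-- The matrix with rows `(1, 0)` and `(m, 1)`. -/
def lowerUnipotent (m : ℤ) : SL(2, ℤ) := ⟨!![1, 0; m, 1], by simp⟩

lemma lowerUnipotent_mem_Gamma0 {p : ℕ} (m : ℤ) : lowerUnipotent (p * m) ∈ Gamma0 p := by
  rw [Gamma0_mem]; simp [lowerUnipotent]

lemma lowerUnipotent_eq_conj (m : ℤ) : lowerUnipotent m = S * T ^ (-m) * S⁻¹ := by
  rw [eq_mul_inv_iff_mul_eq]
  ext i j
  rw [Matrix.SpecialLinearGroup.coe_mul, Matrix.SpecialLinearGroup.coe_mul, coe_T_zpow, coe_S]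
  fin_cases i <;> fin_cases j <;> simp [lowerUnipotent]

lemma lowerUnipotent_mul (m j : ℤ) : lowerUnipotent (m * j) = lowerUnipotent m ^ j := by
  rw [lowerUnipotent_eq_conj, lowerUnipotent_eq_conj, conj_zpow, ← zpow_mul, neg_mul]

lemma T_mem_Gamma0 (p : ℕ) : T ∈ Gamma0 p := by
  rw [Gamma0_mem]; simp [T]

/-- Two elements of `Γ₀(p)` with the same second column differ by a power of
`lowerUnipotent p`. -/
lemma exists_eq_mul_lowerUnipotent {p : ℕ} {γ δ : SL(2, ℤ)} (hγ : γ ∈ Gamma0 p)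
    (hδ : δ ∈ Gamma0 p) (h0 : γ 0 1 = δ 0 1) (h1 : γ 1 1 = δ 1 1) :
    ∃ j : ℤ, γ = δ * lowerUnipotent p ^ j := by
  have hmem : δ⁻¹ * γ ∈ Gamma0 p := mul_mem (inv_mem hδ) hγ
  have hdet := δ.det_coe
  rw [Matrix.det_fin_two] at hdet
  have hdet' := γ.det_coe
  rw [Matrix.det_fin_two] at hdet'
  have e := Matrix.SpecialLinearGroup.SL2_inv_expl δ
  rw [Gamma0_mem, ZMod.intCast_zmod_eq_zero_iff_dvd] at hmem
  obtain ⟨j, hj⟩ := hmem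
  refine ⟨j, ?_⟩
  rw [← inv_mul_eq_iff_eq_mul, ← lowerUnipotent_mul, ← hj]
  have hM : ((δ⁻¹ * γ : SL(2, ℤ)) : Matrix (Fin 2) (Fin 2) ℤ) =
      !![δ 1 1, -δ 0 1; -δ 1 0, δ 0 0] * !![γ 0 0, γ 0 1; γ 1 0, γ 1 1] := by
    rw [Matrix.SpecialLinearGroup.coe_mul, Matrix.SpecialLinearGroup.SL2_inv_expl]
    congr 1
    exact Matrix.eta_fin_two _
  ext i k
  fin_cases i <;> fin_cases k
  · change ((δ⁻¹ * γ : SL(2, ℤ)) : Matrix (Fin 2) (Fin 2) ℤ) 0 0 = 1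
    rw [hM]; simp; rw [← h0, ← h1]; linarith
  · change ((δ⁻¹ * γ : SL(2, ℤ)) : Matrix (Fin 2) (Fin 2) ℤ) 0 1 = 0
    rw [hM]; simp; rw [← h0, ← h1]; ring
  · rfl
  · change ((δ⁻¹ * γ : SL(2, ℤ)) : Matrix (Fin 2) (Fin 2) ℤ) 1 1 = 1
    rw [hM]; simp; rw [h0, h1]; linarith

open Classical in
/-- A chosen element of `Γ₀(p)` with second column `(u, q)`, if there is one. -/
def columnRep (p : ℕ) (q u : ℤ) : Gamma0 p :=
  if h : ∃ γ : Gamma0 p, (γ : SL(2, ℤ)) 0 1 = u ∧ (γ : SL(2, ℤ)) 1 1 = q then h.choose else 1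

lemma columnRep_spec {p : ℕ} (γ : Gamma0 p) :
    ((columnRep p ((γ : SL(2, ℤ)) 1 1) ((γ : SL(2, ℤ)) 0 1) : SL(2, ℤ)) 0 1 =
      (γ : SL(2, ℤ)) 0 1) ∧
    ((columnRep p ((γ : SL(2, ℤ)) 1 1) ((γ : SL(2, ℤ)) 0 1) : SL(2, ℤ)) 1 1 =
      (γ : SL(2, ℤ)) 1 1) := by
  have h : ∃ δ : Gamma0 p, (δ : SL(2, ℤ)) 0 1 = (γ : SL(2, ℤ)) 0 1 ∧
    (δ : SL(2, ℤ)) 1 1 = (γ : SL(2, ℤ)) 1 1 := ⟨γ, rfl, rfl⟩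
  rw [columnRep, dif_pos h]
  exact h.choose_spec

/-- A subgroup of `Γ₀(p)` containing `T`, `lowerUnipotent p` and all chosen representatives with
second column `(u, q)`, `1 ≤ u < q ≤ Q`, contains every element with lower right entry in
`[1, Q]`. -/
lemma mem_of_columnRep_mem {p : ℕ} (G : Subgroup (Gamma0 p)) {Q : ℤ}
    (hT : ⟨T, T_mem_Gamma0 p⟩ ∈ G)
    (hL : ∀ L : Gamma0 p, (L : SL(2, ℤ)) = lowerUnipotent p → L ∈ G)
    (hrep : ∀ q u, 1 ≤ u → u < q → q ≤ Q → columnRep p q u ∈ G)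
    (γ : Gamma0 p) (h1 : 1 ≤ (γ : SL(2, ℤ)) 1 1) (hQ : (γ : SL(2, ℤ)) 1 1 ≤ Q) : γ ∈ G := by
  set q := (γ : SL(2, ℤ)) 1 1 with hq
  set b := (γ : SL(2, ℤ)) 0 1 with hb
  let τ : Gamma0 p := ⟨T, T_mem_Gamma0 p⟩
  let Λ : Gamma0 p := ⟨lowerUnipotent p, by simpa using lowerUnipotent_mem_Gamma0 (p := p) 1⟩
  suffices h : τ ^ (-(b / q)) * γ ∈ G by
    have := G.mul_mem (G.zpow_mem hT (b / q)) h
    rwa [← mul_assoc, ← zpow_add, add_neg_cancel, zpow_zero, one_mul] at this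
  set γ' := τ ^ (-(b / q)) * γ with hγ'
  have hM : ((γ' : SL(2, ℤ)) : Matrix (Fin 2) (Fin 2) ℤ) =
      !![1, -(b / q); 0, 1] * !![(γ : SL(2, ℤ)) 0 0, b; (γ : SL(2, ℤ)) 1 0, q] := by
    rw [hγ', Subgroup.coe_mul, Matrix.SpecialLinearGroup.coe_mul, Subgroup.coe_zpow, coe_T_zpow]
    congr 1
    exact Matrix.eta_fin_two _
  have h01 : (γ' : SL(2, ℤ)) 0 1 = b % q := by
    rw [hM]; simp; rw [Int.emod_def]; ring
  have h11 : (γ' : SL(2, ℤ)) 1 1 = q := by rw [hM]; simp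
  have hcol (δ : Gamma0 p) (hδ : δ ∈ G) (h0 : (γ' : SL(2, ℤ)) 0 1 = (δ : SL(2, ℤ)) 0 1)
      (h1 : (γ' : SL(2, ℤ)) 1 1 = (δ : SL(2, ℤ)) 1 1) : γ' ∈ G := by
    obtain ⟨j, hj⟩ := exists_eq_mul_lowerUnipotent γ'.2 δ.2 h0 h1
    have : γ' = δ * Λ ^ j := Subtype.ext (by simpa using hj)
    rw [this]
    exact G.mul_mem hδ (G.zpow_mem (hL _ rfl) j)
  have hnn := Int.emod_nonneg b (by omega : q ≠ 0)
  have hlt := Int.emod_lt_of_pos b (by omega : 0 < q)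
  rcases hnn.eq_or_lt with h0 | h0
  · -- here `q` divides the second column, so `q = 1`
    have hdet := (γ' : SL(2, ℤ)).det_coe
    rw [Matrix.det_fin_two, h01, h11, ← h0, zero_mul, sub_zero] at hdet
    have hq1 : q = 1 := by
      rcases Int.isUnit_iff.1 (IsUnit.of_mul_eq_one _ ((mul_comm _ _).trans hdet)) with h | h <;>
        omega
    refine hcol 1 G.one_mem ?_ ?_
    · rw [h01, ← h0]; simp
    · rw [h11, hq1]; simp
  · have hs := columnRep_spec γ'
    rw [h01, h11] at hs
    exact hcol _ (hrep q (b % q) h0 hlt hQ) (h01.trans hs.1.symm) (h11.trans hs.2.symm)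

/-- The subgroup generated by elements with small lower right entry contains no principal
congruence subgroup: a homomorphism from `Γ₀(p)` to a vector space maps it into a space of too
small a dimension. -/
theorem not_Gamma_le_smallSubgroup {p : ℕ} (hp : p.Prime) (hp24 : 24 ≤ p) (N : ℕ) (hN : 0 < N) :
    ¬ Gamma N ≤ smallSubgroup p := by
  classical
  intro hle
  have : Fact p.Prime := ⟨hp⟩
  have : NeZero N := ⟨hN.ne'⟩
  obtain ⟨M, _, _, _, φ, hdim, hneg⟩ := exists_gamma0_hom p
  let Q : ℕ := Nat.sqrt ((p - 24) / 3)
  have hQ : 3 * (Q * Q) ≤ p - 24 := by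
    have := Nat.sqrt_le ((p - 24) / 3)
    change Q * Q ≤ _ at this
    omega
  let Λ : Gamma0 p := ⟨lowerUnipotent p, by simpa using lowerUnipotent_mem_Gamma0 (p := p) 1⟩
  let pairs : Finset (Σ _ : ℕ, ℕ) := (Finset.range (Q + 1)).sigma fun q => Finset.Ico 1 q
  let I : Finset M := {(φ ⟨T, T_mem_Gamma0 p⟩).toAdd, (φ Λ).toAdd} ∪
    pairs.image fun x => (φ (columnRep p x.1 x.2)).toAdd
  have hpairs : 2 * pairs.card ≤ Q * Q := by
    rw [Finset.card_sigma]
    generalize Q = m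
    induction m with
    | zero => simp
    | succ m ih => rw [Finset.sum_range_succ, mul_add]; simp at ih ⊢; nlinarith
  have hI : 6 * I.card ≤ 12 + (p - 24) := by
    have h1 : I.card ≤ _ + _ := Finset.card_union_le _ _
    have h2 := Finset.card_le_two (a := (φ ⟨T, T_mem_Gamma0 p⟩).toAdd) (b := (φ Λ).toAdd)
    have h3 : (pairs.image fun x => (φ (columnRep p x.1 x.2)).toAdd).card ≤ pairs.card :=
      Finset.card_image_le
    omega
  let K : Submodule ℚ M := Submodule.span ℚ I
  let G : Subgroup (Gamma0 p) :=
    { carrier := {γ | (φ γ).toAdd ∈ K}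
      mul_mem' := fun {a b} ha hb => by
        simp only [Set.mem_ofPred_eq, map_mul, toAdd_mul] at *
        exact add_mem ha hb
      one_mem' := by simp
      inv_mem' := fun {a} ha => by
        simp only [Set.mem_ofPred_eq, map_inv, toAdd_inv] at *
        exact neg_mem ha }
  have hG : smallSubgroup p ≤ G.map (Gamma0 p).subtype := by
    rw [smallSubgroup, Subgroup.closure_le]
    rintro γ (rfl | ⟨h, h1, h2⟩)
    · have hm := smallSubgroup_le p (neg_one_mem_smallSubgroup p)
      refine ⟨⟨-1, hm⟩, ?_, rfl⟩
      change (φ _).toAdd ∈ K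
      rw [hneg _ rfl]
      exact zero_mem K
    · refine ⟨⟨γ, h⟩, ?_, rfl⟩
      refine mem_of_columnRep_mem G (Q := Q) ?_ ?_ ?_ _ h1 ?_
      · exact Submodule.subset_span (by simp [I])
      · intro L hL
        have : L = Λ := Subtype.ext hL
        rw [this]
        exact Submodule.subset_span (by simp [I])
      · intro q u hu huq hqQ
        lift q to ℕ using by omega
        lift u to ℕ using by omega
        refine Submodule.subset_span (Finset.mem_coe.2 (Finset.mem_union_right _ ?_))
        refine Finset.mem_image.2 ⟨⟨q, u⟩, ?_, rfl⟩
        simp only [pairs, Finset.mem_sigma, Finset.mem_range, Finset.mem_Ico]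
        omega
      · change γ 1 1 ≤ _
        generalize γ 1 1 = d at *
        lift d to ℕ using by omega
        have : d ≤ Q := by
          rw [Nat.le_sqrt, Nat.le_div_iff_mul_le (by norm_num)]
          zify [hp24]
          nlinarith
        exact_mod_cast this
  -- every element of `Γ₀(p)` has a power in `Γ(N)`
  have hle' : Submodule.span ℚ (Set.range fun γ => (φ γ).toAdd) ≤ K := by
    rw [Submodule.span_le]
    rintro _ ⟨γ, rfl⟩
    obtain ⟨m, hm, -, hmem⟩ := Subgroup.exists_pow_mem_of_index_ne_zero
      (Subgroup.FiniteIndex.index_ne_zero (H := Gamma N)) (γ : SL(2, ℤ))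
    obtain ⟨δ, hδ, hδγ⟩ := hG (hle hmem)
    have : δ = γ ^ m := Subtype.ext (by simpa using hδγ)
    rw [this] at hδ
    change (φ (γ ^ m)).toAdd ∈ K at hδ
    rw [map_pow, toAdd_pow, ← Nat.cast_smul_eq_nsmul ℚ] at hδ
    exact (K.smul_mem_iff (by exact_mod_cast hm.ne')).1 hδ
  have h1 := Submodule.finrank_mono hle'
  have h2 : Module.finrank ℚ K ≤ I.card := finrank_span_finset_le_card I
  omega

/-! ### Subseries of Eisenstein series -/

section RowSeries
open EisensteinSeries Filter Topology
open scoped Manifold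

/-- A lower bound for `|v₀ z + v₁|²` which depends on `z` explicitly. -/
lemma im_sq_mul_norm_sq_le (z : ℍ) (v : Fin 2 → ℤ) :
    z.im ^ 2 * ‖v‖ ^ 2 ≤ (1 + ‖(z : ℂ)‖ ^ 2) * ‖(v 0 : ℂ) * z + v 1‖ ^ 2 := by
  have h1 : ‖v‖ ^ 2 ≤ (v 0 : ℝ) ^ 2 + (v 1 : ℝ) ^ 2 := by
    rw [norm_eq_max_natAbs]
    rcases max_choice (v 0).natAbs (v 1).natAbs with h | h <;> rw [h] <;>
      simp [Nat.cast_natAbs, sq_nonneg]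
  have h2 : ‖(z : ℂ)‖ ^ 2 = z.re ^ 2 + z.im ^ 2 := by
    rw [Complex.sq_norm, Complex.normSq_apply]; simp; ring
  have h3 : ‖(v 0 : ℂ) * z + v 1‖ ^ 2 = (v 0 * z.re + v 1) ^ 2 + (v 0 * z.im) ^ 2 := by
    rw [Complex.sq_norm, Complex.normSq_apply]; simp; ring
  rw [h2, h3]
  have h4 : z.im ^ 2 * ‖v‖ ^ 2 ≤ z.im ^ 2 * ((v 0 : ℝ) ^ 2 + (v 1 : ℝ) ^ 2) := by gcongr
  nlinarith [sq_nonneg (v 0 * (z.re ^ 2 + z.im ^ 2) + v 1 * z.re), sq_nonneg (v 0 * z.re + v 1)]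

/-- A bound for `‖v‖² / |v₀ z + v₁|²`, uniform in the nonzero real vectors `v`. -/
def heightFactor (z : ℍ) : ℝ := (1 + ‖(z : ℂ)‖ ^ 2) / z.im ^ 2

lemma heightFactor_pos (z : ℍ) : 0 < heightFactor z := by
  have := z.im_pos
  unfold heightFactor; positivity

lemma continuous_heightFactor : Continuous heightFactor := by
  unfold heightFactor
  exact Continuous.div (by fun_prop) (by fun_prop) fun z => pow_ne_zero 2 z.im_ne_zero

lemma norm_eisSummand_le (n : ℕ) (v : Fin 2 → ℤ) (z : ℍ) :
    ‖eisSummand (2 * n : ℕ) v z‖ ≤ heightFactor z ^ n * ((‖v‖ ^ 2) ^ n)⁻¹ := by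
  have hz := z.im_pos
  rw [eisSummand, zpow_neg, zpow_natCast, norm_inv, norm_pow, pow_mul]
  rcases eq_or_ne v 0 with rfl | hv
  · rcases Nat.eq_zero_or_pos n with rfl | hn
    · simp
    · simp [hn.ne']
  have hv' : 0 < ‖v‖ := norm_pos_iff.2 hv
  have h := im_sq_mul_norm_sq_le z v
  rw [← inv_pow, ← inv_pow (‖v‖ ^ 2), ← mul_pow]
  have hpos : 0 < ‖(v 0 : ℂ) * z + v 1‖ ^ 2 := by
    by_contra h0
    have h0 : ‖(v 0 : ℂ) * z + v 1‖ ^ 2 = 0 := le_antisymm (not_lt.1 h0) (by positivity)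
    rw [h0, mul_zero] at h
    have : 0 < z.im ^ 2 * ‖v‖ ^ 2 := by positivity
    linarith
  refine pow_le_pow_left₀ (by positivity) ?_ n
  rw [heightFactor, ← div_eq_mul_inv, div_div, inv_le_comm₀ hpos (by positivity), inv_div,
    div_le_iff₀ (by positivity)]
  linarith

lemma summable_norm_sq_pow_inv {n : ℕ} (hn : 2 ≤ n) :
    Summable fun v : Fin 2 → ℤ => ((‖v‖ ^ 2) ^ n)⁻¹ := by
  refine (summable_one_div_norm_rpow (k := (2 * n : ℕ)) ?_).congr fun v => ?_
  · exact_mod_cast (by omega : 2 < 2 * n)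
  · rw [Real.rpow_neg (norm_nonneg _), Real.rpow_natCast, pow_mul]

/-- The series `∑ ε(v) (v₀ z + v₁)^{-2n}` over integral row vectors `v`. -/
def rowSeries (ε : (Fin 2 → ℤ) → ℂ) (n : ℕ) (z : ℍ) : ℂ :=
  ∑' v, ε v * eisSummand (2 * n : ℕ) v z

variable {ε : (Fin 2 → ℤ) → ℂ} {n : ℕ}

lemma norm_rowSeries_term_le (hε : ∀ v, ‖ε v‖ ≤ 1) (v : Fin 2 → ℤ) (z : ℍ) :
    ‖ε v * eisSummand (2 * n : ℕ) v z‖ ≤ heightFactor z ^ n * ((‖v‖ ^ 2) ^ n)⁻¹ := by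
  rw [norm_mul]
  exact (mul_le_of_le_one_left (norm_nonneg _) (hε v)).trans (norm_eisSummand_le n v z)

lemma norm_rowSeries_le (hε : ∀ v, ‖ε v‖ ≤ 1) (hn : 2 ≤ n) (z : ℍ) :
    ‖rowSeries ε n z‖ ≤ heightFactor z ^ n * ∑' v : Fin 2 → ℤ, ((‖v‖ ^ 2) ^ n)⁻¹ := by
  rw [← tsum_mul_left]
  exact tsum_of_norm_bounded ((summable_norm_sq_pow_inv hn).mul_left _).hasSum
    fun v => norm_rowSeries_term_le hε v z

lemma mdifferentiable_rowSeries (hε : ∀ v, ‖ε v‖ ≤ 1) (hn : 2 ≤ n) :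
    MDifferentiable 𝓘(ℂ) 𝓘(ℂ) (rowSeries ε n) := by
  rw [UpperHalfPlane.mdifferentiable_iff]
  intro τ hτ
  -- near `τ` the height factor is bounded, which makes the convergence uniform there
  set z₀ : ℍ := ⟨τ, hτ⟩ with hz₀
  let U : Set ℂ := UpperHalfPlane.coe '' {z : ℍ | heightFactor z < heightFactor z₀ + 1}
  have hU : IsOpen U := isOpenEmbedding_coe.isOpenMap _
    (isOpen_lt continuous_heightFactor continuous_const)
  have hτU : τ ∈ U := ⟨z₀, by simp, rfl⟩
  have hUim {w : ℂ} (hw : w ∈ U) : 0 < w.im := by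
    obtain ⟨z, -, rfl⟩ := hw; exact z.im_pos
  have key : DifferentiableOn ℂ
      (fun w => ∑' v, (ε v * eisSummand (2 * n : ℕ) v (ofComplex w))) U := by
    refine Complex.differentiableOn_tsum_of_summable_norm
      (u := fun v => (heightFactor z₀ + 1) ^ n * ((‖v‖ ^ 2) ^ n)⁻¹)
      ((summable_norm_sq_pow_inv hn).mul_left _) (fun v => ?_) hU fun v w hw => ?_
    · intro w hw
      have := (eisSummand_extension_differentiableOn (2 * n : ℕ) v).differentiableAt
        (isOpen_upperHalfPlaneSet.mem_nhds (hUim hw))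
      exact (this.const_mul _).differentiableWithinAt
    · obtain ⟨z, hz, rfl⟩ := hw
      rw [ofComplex_apply]
      refine (norm_rowSeries_term_le hε v z).trans ?_
      have := (heightFactor_pos z).le
      have hz : heightFactor z < heightFactor z₀ + 1 := hz
      gcongr
  exact (key.differentiableAt (hU.mem_nhds hτU)).differentiableWithinAt

/-- The point `i y` of the upper half-plane (`i` itself if `y ≤ 0`). -/
def imagPoint (y : ℝ) : ℍ := if h : 0 < y then ⟨y * Complex.I, by simpa using h⟩ else I

lemma coe_imagPoint {y : ℝ} (h : 0 < y) : (imagPoint y : ℂ) = y * Complex.I := by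
  rw [imagPoint, dif_pos h]

lemma heightFactor_imagPoint_le {y : ℝ} (h : 1 ≤ y) : heightFactor (imagPoint y) ≤ 2 := by
  have h0 : 0 < y := by linarith
  rw [heightFactor, ← coe_im, coe_imagPoint h0]
  simp only [norm_mul, Complex.norm_real, Complex.norm_I, mul_one, Real.norm_eq_abs, sq_abs,
    Complex.mul_im, Complex.ofReal_re, Complex.I_im, Complex.ofReal_im, Complex.I_re, mul_zero,
    add_zero]
  rw [div_le_iff₀ (by positivity)]
  nlinarith

/-- The value at infinity of the series transformed by `γ`: along the imaginary axis only the
vectors `v` for which `v γ` has first entry `0` contribute. -/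
lemma tendsto_tsum_eisSummand (hε : ∀ v, ‖ε v‖ ≤ 1) (hn : 2 ≤ n) (γ : SL(2, ℤ)) :
    Tendsto (fun y => ∑' v, ε v * eisSummand (2 * n : ℕ) (Matrix.vecMul v γ.1) (imagPoint y))
      atTop
      (𝓝 (∑' v, ε v * if Matrix.vecMul v γ.1 0 = 0
        then ((Matrix.vecMul v γ.1 1 : ℤ) : ℂ) ^ (-((2 * n : ℕ) : ℤ)) else 0)) := by
  have hinj : Function.Injective fun v : Fin 2 → ℤ => Matrix.vecMul v γ.1 := by
    intro v w h
    have := congrArg (fun x => Matrix.vecMul x (γ⁻¹).1) h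
    simpa only [Matrix.vecMul_vecMul, ← Matrix.SpecialLinearGroup.coe_mul, mul_inv_cancel,
      Matrix.SpecialLinearGroup.coe_one, Matrix.vecMul_one] using this
  refine tendsto_tsum_of_dominated_convergence
    (bound := fun v => 2 ^ n * ((‖Matrix.vecMul v γ.1‖ ^ 2) ^ n)⁻¹)
    (((summable_norm_sq_pow_inv hn).comp_injective hinj).mul_left _) (fun v => ?_) ?_
  · refine Tendsto.const_mul _ ?_
    split_ifs with h
    · refine tendsto_const_nhds.congr fun y => ?_
      simp [eisSummand, h]
    · have h' : ((Matrix.vecMul v γ.1 0 : ℤ) : ℝ) ≠ 0 := by exact_mod_cast h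
      rw [tendsto_zero_iff_norm_tendsto_zero]
      have hlim : Tendsto (fun y : ℝ =>
          (|((Matrix.vecMul v γ.1 0 : ℤ) : ℝ)| * y) ^ (-((2 * n : ℕ) : ℤ))) atTop (𝓝 0) := by
        refine (tendsto_zpow_atTop_zero (by omega)).comp ?_
        exact tendsto_id.const_mul_atTop (abs_pos.2 h')
      refine squeeze_zero' (Eventually.of_forall fun _ => norm_nonneg _) ?_ hlim
      filter_upwards [eventually_gt_atTop 0] with y hy
      rw [eisSummand, norm_zpow, zpow_neg, zpow_neg, coe_imagPoint hy, zpow_natCast, zpow_natCast]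
      have hpos : 0 < |((Matrix.vecMul v γ.1 0 : ℤ) : ℝ)| * y := mul_pos (abs_pos.2 h') hy
      gcongr
      refine le_trans (le_of_eq ?_) (Complex.abs_im_le_norm _)
      simp [abs_mul, abs_of_pos hy]
  · filter_upwards [eventually_ge_atTop 1] with y hy v
    rw [norm_mul]
    refine (mul_le_of_le_one_left (norm_nonneg _) (hε v)).trans
      ((norm_eisSummand_le n _ _).trans ?_)
    have := heightFactor_imagPoint_le hy
    have h0 := (heightFactor_pos (imagPoint y)).le
    gcongr

end RowSeries

/-! ### The cusp form and its Fricke transform -/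

section Construction
open EisensteinSeries Filter Topology
open scoped Manifold

lemma discriminant_smul (γ : SL(2, ℤ)) (z : ℍ) :
    ModularForm.discriminant (γ • z) =
      denom γ z ^ 12 * ModularForm.discriminant z :=
  SlashInvariantForm.slash_action_eqn'' CuspForm.discriminant (MonoidHom.mem_range.2 ⟨γ, rfl⟩) z

lemma norm_discriminant_mul_im_smul (γ : SL(2, ℤ)) (z : ℍ) :
    ‖ModularForm.discriminant (γ • z)‖ * (γ • z).im ^ 6 =
      ‖ModularForm.discriminant z‖ * z.im ^ 6 := by
  have h : ‖denom γ z‖ ≠ 0 := norm_ne_zero_iff.2 (denom_ne_zero _ _)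
  rw [discriminant_smul, ModularGroup.im_smul_eq_div_normSq, norm_mul, norm_pow,
    Complex.normSq_eq_norm_sq]
  field_simp

lemma exists_discriminant_bound :
    ∃ C : ℝ, 0 < C ∧ ∀ z : ℍ, ‖ModularForm.discriminant z‖ * z.im ^ 6 ≤ C * Real.exp (-z.im) := by
  obtain ⟨C₁, hC₁⟩ := CuspFormClass.exists_bound CuspForm.discriminant
  have hdecay := CuspFormClass.exp_decay_atImInfty (h := 1) CuspForm.discriminant one_pos
    one_mem_strictPeriods_SL
  have hpow : (fun z : ℍ => z.im ^ 6 * Real.exp (-2 * Real.pi * z.im / 1)) =O[atImInfty]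
      fun z => Real.exp (-z.im) := by
    have h1 : (fun y : ℝ => y ^ 6) =o[atTop] fun y => Real.exp y :=
      Real.isLittleO_pow_exp_atTop
    have h2 : (fun y : ℝ => y ^ 6 * Real.exp (-2 * Real.pi * y / 1)) =O[atTop]
        fun y => Real.exp (-y) := by
      refine (h1.isBigO.mul (Asymptotics.isBigO_refl _ _)).trans ?_
      refine Asymptotics.IsBigO.of_bound 1 ?_
      filter_upwards [eventually_ge_atTop 0] with y hy
      rw [← Real.exp_add, one_mul, Real.norm_eq_abs, Real.norm_eq_abs, Real.abs_exp, Real.abs_exp,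
        Real.exp_le_exp]
      nlinarith [Real.pi_gt_three]
    exact h2.comp_tendsto tendsto_comap
  have hO : (fun z : ℍ => ‖ModularForm.discriminant z‖ * z.im ^ 6) =O[atImInfty]
      fun z => Real.exp (-z.im) := by
    refine Asymptotics.IsBigO.trans ?_ hpow
    exact ((Asymptotics.isBigO_refl (fun z : ℍ => z.im ^ 6) _).mul hdecay.norm_left).congr_left
      fun z => mul_comm _ _
  obtain ⟨C₂, hC₂⟩ := hO.bound
  obtain ⟨A, hA⟩ := (UpperHalfPlane.atImInfty_mem _).1 hC₂
  have hC₁' (z : ℍ) : ‖ModularForm.discriminant z‖ * z.im ^ 6 ≤ C₁ := by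
    have := hC₁ z
    rw [CuspForm.coe_discriminant] at this
    have h6 : z.im ^ ((12 : ℤ) / 2 : ℝ) = z.im ^ 6 := by
      rw [← Real.rpow_natCast]; norm_num
    rwa [h6, le_div_iff₀ (pow_pos z.im_pos 6)] at this
  refine ⟨max 1 (max C₂ (C₁ * Real.exp A)), by positivity, fun z => ?_⟩
  rcases le_total A z.im with h | h
  · have := hA z h
    simp only [Set.mem_ofPred_eq, Real.norm_eq_abs, Real.abs_exp] at this
    refine (le_abs_self _).trans (this.trans ?_)
    gcongr
    exact (le_max_left _ _).trans (le_max_right _ _)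
  · have hC0 : 0 ≤ C₁ := le_trans (by have := z.im_pos; positivity) (hC₁' z)
    calc _ ≤ C₁ * 1 := by simpa using hC₁' z
      _ ≤ C₁ * (Real.exp A * Real.exp (-z.im)) := by
        gcongr
        rw [← Real.exp_add]
        exact Real.one_le_exp (by linarith)
      _ = C₁ * Real.exp A * Real.exp (-z.im) := by ring
      _ ≤ _ := by
        gcongr
        exact (le_max_right _ _).trans (le_max_right _ _)

/-- Since `|Δ(z)| (im z)⁶` is invariant under `SL(2, ℤ)`, the height of any translate of `z`
may serve to estimate it; at a point near a cusp this is the height above that cusp. -/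
lemma exists_discriminant_bound_orbit :
    ∃ C : ℝ, 0 < C ∧ ∀ (z : ℍ) (δ : SL(2, ℤ)),
      ‖ModularForm.discriminant z‖ * z.im ^ 6 ≤ C * Real.exp (-(δ • z).im) := by
  obtain ⟨C, hC, h⟩ := exists_discriminant_bound
  exact ⟨C, hC, fun z δ => norm_discriminant_mul_im_smul δ z ▸ h (δ • z)⟩

/-- The bottom rows of the elements of `smallSubgroup p`. -/
def rowSet (p : ℕ) : Set (Fin 2 → ℤ) := {v | ∃ h ∈ smallSubgroup p, v = h.1 1}

lemma vecMul_mem_rowSet {p : ℕ} {h : SL(2, ℤ)} (hh : h ∈ smallSubgroup p) {v : Fin 2 → ℤ}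
    (hv : v ∈ rowSet p) : Matrix.vecMul v h.1 ∈ rowSet p := by
  obtain ⟨h', hh', rfl⟩ := hv
  refine ⟨h' * h, mul_mem hh' hh, ?_⟩
  rw [Matrix.SpecialLinearGroup.coe_mul, Matrix.mul_apply_eq_vecMul]

lemma vecMul_mem_rowSet_iff {p : ℕ} {h : SL(2, ℤ)} (hh : h ∈ smallSubgroup p) {v : Fin 2 → ℤ} :
    Matrix.vecMul v h.1 ∈ rowSet p ↔ v ∈ rowSet p := by
  refine ⟨fun hv => ?_, vecMul_mem_rowSet hh⟩
  have := vecMul_mem_rowSet (inv_mem hh) hv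
  rwa [Matrix.vecMul_vecMul, ← Matrix.SpecialLinearGroup.coe_mul, mul_inv_cancel,
    Matrix.SpecialLinearGroup.coe_one, Matrix.vecMul_one] at this

/-- Right multiplication by `γ`, a permutation of the integral row vectors. -/
def vecMulEquiv (γ : SL(2, ℤ)) : (Fin 2 → ℤ) ≃ (Fin 2 → ℤ) where
  toFun v := Matrix.vecMul v γ.1
  invFun v := Matrix.vecMul v (γ⁻¹).1
  left_inv v := by
    dsimp only
    rw [Matrix.vecMul_vecMul, ← Matrix.SpecialLinearGroup.coe_mul, mul_inv_cancel,
      Matrix.SpecialLinearGroup.coe_one, Matrix.vecMul_one]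
  right_inv v := by
    dsimp only
    rw [Matrix.vecMul_vecMul, ← Matrix.SpecialLinearGroup.coe_mul, inv_mul_cancel,
      Matrix.SpecialLinearGroup.coe_one, Matrix.vecMul_one]

lemma rowSeries_smul (ε : (Fin 2 → ℤ) → ℂ) (n : ℕ) (γ : SL(2, ℤ)) (z : ℍ) :
    rowSeries ε n (γ • z) = denom γ z ^ (2 * n) *
      ∑' v, ε v * eisSummand (2 * n : ℕ) (Matrix.vecMul v γ.1) z := by
  rw [rowSeries, ← tsum_mul_left]
  refine tsum_congr fun v => ?_
  rw [eisSummand_SL2_apply, zpow_natCast]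
  ring

variable (p : ℕ) (χ : DirichletCharacter ℂ p) (n : ℕ)

open Classical in
/-- The coefficient `χ(v₁)⁻¹` on bottom rows `v` of elements of `smallSubgroup p`, and `0` on
all other vectors. -/
def rowCoeff (v : Fin 2 → ℤ) : ℂ := if v ∈ rowSet p then χ⁻¹ (v 1 : ZMod p) else 0

lemma norm_rowCoeff_le (v : Fin 2 → ℤ) : ‖rowCoeff p χ v‖ ≤ 1 := by
  unfold rowCoeff
  split_ifs
  · exact DirichletCharacter.norm_le_one _ _
  · simp

variable {p}

lemma isUnit_of_mem_Gamma0 {γ : SL(2, ℤ)} (hγ : γ ∈ Gamma0 p) :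
    IsUnit ((γ 1 1 : ℤ) : ZMod p) := by
  have hdet := γ.det_coe
  rw [Matrix.det_fin_two] at hdet
  rw [Gamma0_mem] at hγ
  have := congrArg (Int.cast : ℤ → ZMod p) hdet
  push_cast at this
  rw [hγ, mul_zero, sub_zero, mul_comm] at this
  exact IsUnit.of_mul_eq_one _ this

lemma character_mul_rowCoeff_vecMul {h : SL(2, ℤ)} (hh : h ∈ smallSubgroup p) (v : Fin 2 → ℤ) :
    χ (h 1 1 : ℤ) * rowCoeff p χ (Matrix.vecMul v h.1) = rowCoeff p χ v := by
  unfold rowCoeff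
  by_cases hv : v ∈ rowSet p
  · rw [if_pos hv, if_pos (vecMul_mem_rowSet hh hv)]
    obtain ⟨h', hh', rfl⟩ := hv
    have h0 := (Gamma0_mem).1 (smallSubgroup_le p hh')
    have hu := isUnit_of_mem_Gamma0 (smallSubgroup_le p hh)
    have h1 : ((Matrix.vecMul (h'.1 1) h.1 1 : ℤ) : ZMod p) =
        ((h 1 1 : ℤ) : ZMod p) * ((h' 1 1 : ℤ) : ZMod p) := by
      rw [Matrix.vecMul_eq_sum]
      simp [Fin.sum_univ_two, h0, mul_comm]
    rw [h1, map_mul, ← mul_assoc, ← MulChar.mul_apply, mul_inv_cancel, MulChar.one_apply hu,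
      one_mul]
  · rw [if_neg hv, if_neg (mt (vecMul_mem_rowSet_iff hh).1 hv), mul_zero]

/-- The Eisenstein series of weight `2 n` and character `χ` for `smallSubgroup p`. -/
def smallEisenstein : ℍ → ℂ := rowSeries (rowCoeff p χ) n

lemma smallEisenstein_smul {h : SL(2, ℤ)} (hh : h ∈ smallSubgroup p) (z : ℍ) :
    smallEisenstein χ n (h • z) = χ (h 1 1 : ℤ) * denom h z ^ (2 * n) * smallEisenstein χ n z := by
  rw [smallEisenstein, rowSeries_smul, mul_comm (χ _), mul_assoc]
  congr 1
  rw [rowSeries, ← tsum_mul_left, ← (vecMulEquiv h).tsum_eq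
    fun v => χ (h 1 1 : ℤ) * (rowCoeff p χ v * eisSummand (2 * n : ℕ) v z)]
  refine tsum_congr fun v => ?_
  conv_lhs => rw [← character_mul_rowCoeff_vecMul χ hh v]
  rw [mul_assoc]
  rfl

/-- The form `f`, of weight `12 + 2 n` and character `χ` for `smallSubgroup p`. -/
def smallCuspForm (z : ℍ) : ℂ := ModularForm.discriminant z * smallEisenstein χ n z

lemma smallCuspForm_smul {h : SL(2, ℤ)} (hh : h ∈ smallSubgroup p) (z : ℍ) :
    smallCuspForm χ n (h • z) =
      χ (h 1 1 : ℤ) * denom h z ^ (12 + 2 * n) * smallCuspForm χ n z := by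
  rw [smallCuspForm, smallEisenstein_smul χ n hh, discriminant_smul, smallCuspForm]
  ring

variable {n}

lemma mdifferentiable_smallCuspForm (hn : 2 ≤ n) :
    MDifferentiable 𝓘(ℂ) 𝓘(ℂ) (smallCuspForm χ n) :=
  CuspForm.discriminant.holo'.mul (mdifferentiable_rowSeries (norm_rowCoeff_le p χ) hn)

lemma exists_smallCuspForm_bound (hn : 2 ≤ n) :
    ∃ C : ℝ, 0 < C ∧ ∀ (z : ℍ) (δ : SL(2, ℤ)), ‖smallCuspForm χ n z‖ ≤
      C * ((1 + ‖(z : ℂ)‖ ^ 2) ^ n / z.im ^ (6 + 2 * n)) * Real.exp (-(δ • z).im) := by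
  obtain ⟨C, hC, h⟩ := exists_discriminant_bound_orbit
  set K : ℝ := ∑' v : Fin 2 → ℤ, ((‖v‖ ^ 2) ^ n)⁻¹
  have hK : 0 ≤ K := tsum_nonneg fun v => by positivity
  refine ⟨C * (K + 1), by positivity, fun z δ => ?_⟩
  have hz := z.im_pos
  have hE : ‖smallEisenstein χ n z‖ ≤ heightFactor z ^ n * (K + 1) :=
    (norm_rowSeries_le (norm_rowCoeff_le p χ) hn z).trans
      (by have := (heightFactor_pos z).le; gcongr; linarith)
  have hD : ‖ModularForm.discriminant z‖ ≤ C * Real.exp (-(δ • z).im) / z.im ^ 6 := by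
    rw [le_div_iff₀ (by positivity)]; exact h z δ
  calc ‖smallCuspForm χ n z‖
      = ‖ModularForm.discriminant z‖ * ‖smallEisenstein χ n z‖ := norm_mul _ _
    _ ≤ C * Real.exp (-(δ • z).im) / z.im ^ 6 * (heightFactor z ^ n * (K + 1)) := by gcongr
    _ = _ := by
      rw [heightFactor, div_pow, ← pow_mul, pow_add]
      field_simp

variable (n)

/-- The image `-1 / (p z)` of `z` under the Fricke involution of level `p`. -/
def frickePoint (hp : 0 < p) (z : ℍ) : ℍ :=
  ⟨-1 / (p * z), by
    have hz := z.im_pos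
    have h0 : (0 : ℝ) < p := by exact_mod_cast hp
    have : (-1 / ((p : ℂ) * z)).im = z.im / (p * Complex.normSq z) := by
      rw [Complex.div_im]
      simp [Complex.normSq_mul]
      field_simp
    rw [this]
    have := z.normSq_pos
    positivity⟩

variable (hp : 0 < p)

lemma coe_frickePoint (z : ℍ) : (frickePoint hp z : ℂ) = -1 / (p * z) := rfl

lemma im_frickePoint (z : ℍ) : (frickePoint hp z).im = z.im / (p * ‖(z : ℂ)‖ ^ 2) := by
  have h0 : (0 : ℝ) < p := by exact_mod_cast hp
  rw [← coe_im, coe_frickePoint, ← Complex.normSq_eq_norm_sq, Complex.div_im]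
  have := z.normSq_pos
  simp [Complex.normSq_mul]
  field_simp

/-- The function `g` with `f(-1 / (p z)) = p^{6 + n} z^{12 + 2 n} g(z)` for
`f = smallCuspForm χ n`. -/
def frickeTransform (z : ℍ) : ℂ :=
  ((p : ℂ) ^ (6 + n) * (z : ℂ) ^ (12 + 2 * n))⁻¹ * smallCuspForm χ n (frickePoint hp z)

lemma smallCuspForm_frickePoint (z : ℍ) :
    smallCuspForm χ n (frickePoint hp z) =
      (p : ℂ) ^ (6 + n) * (z : ℂ) ^ (12 + 2 * n) * frickeTransform χ n hp z := by
  have h1 : (p : ℂ) ≠ 0 := by exact_mod_cast hp.ne'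
  have h2 : (z : ℂ) ≠ 0 := z.ne_zero
  rw [frickeTransform, mul_inv_cancel_left₀ (by positivity)]

variable {n}

lemma mdifferentiable_frickeTransform (hn : 2 ≤ n) :
    MDifferentiable 𝓘(ℂ) 𝓘(ℂ) (frickeTransform χ n hp) := by
  have h1 : (p : ℂ) ≠ 0 := by exact_mod_cast hp.ne'
  rw [UpperHalfPlane.mdifferentiable_iff]
  have hf := UpperHalfPlane.mdifferentiable_iff.1 (mdifferentiable_smallCuspForm χ hn)
  have hne {w : ℂ} (hw : w ∈ {w : ℂ | 0 < w.im}) : w ≠ 0 := by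
    rintro rfl; simp at hw
  have h2 : DifferentiableOn ℂ (fun w : ℂ => ((p : ℂ) ^ (6 + n) * w ^ (12 + 2 * n))⁻¹)
      {w : ℂ | 0 < w.im} :=
    DifferentiableOn.inv (by fun_prop) fun w hw =>
      mul_ne_zero (pow_ne_zero _ h1) (pow_ne_zero _ (hne hw))
  have h3 : DifferentiableOn ℂ (fun w : ℂ => -1 / ((p : ℂ) * w)) {w : ℂ | 0 < w.im} :=
    DifferentiableOn.div (by fun_prop) (by fun_prop) fun w hw => mul_ne_zero h1 (hne hw)
  have h4 : Set.MapsTo (fun w : ℂ => -1 / ((p : ℂ) * w)) {w : ℂ | 0 < w.im} {w : ℂ | 0 < w.im} :=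
    fun w hw => (frickePoint hp ⟨w, hw⟩).coe_im_pos
  refine (h2.mul (hf.comp h3 h4)).congr fun w hw => ?_
  have h5 : ofComplex (-1 / ((p : ℂ) * w)) = frickePoint hp ⟨w, hw⟩ :=
    ofComplex_apply_of_im_pos (h4 hw)
  simp only [Function.comp, Pi.mul_apply]
  rw [h5, ofComplex_apply_of_im_pos hw, frickeTransform]

lemma exists_frickeTransform_bound (hn : 2 ≤ n) :
    ∃ C : ℝ, 0 < C ∧ ∀ (z : ℍ) (δ : SL(2, ℤ)), ‖frickeTransform χ n hp z‖ ≤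
      C * ((1 + ‖(z : ℂ)‖ ^ 2) ^ n / z.im ^ (6 + 2 * n)) *
        Real.exp (-(δ • frickePoint hp z).im) := by
  obtain ⟨C, hC, h⟩ := exists_smallCuspForm_bound χ hn
  have h0 : (1 : ℝ) ≤ p := by exact_mod_cast hp
  refine ⟨C * p ^ n, by positivity, fun z δ => ?_⟩
  have hz := z.im_pos
  have hn0 : 0 < ‖(z : ℂ)‖ := norm_pos_iff.2 z.ne_zero
  have h1 : 1 + ‖(frickePoint hp z : ℂ)‖ ^ 2 ≤ (1 + ‖(z : ℂ)‖ ^ 2) / ‖(z : ℂ)‖ ^ 2 := by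
    rw [coe_frickePoint, norm_div, norm_neg, norm_one, norm_mul, Complex.norm_natCast,
      add_div, div_self (by positivity), add_comm]
    gcongr
    rw [div_pow, one_pow, mul_pow]
    gcongr
    nlinarith [one_le_pow₀ h0 (n := 2), sq_nonneg ‖(z : ℂ)‖]
  rw [frickeTransform, norm_mul, norm_inv, norm_mul, norm_pow, norm_pow, Complex.norm_natCast]
  calc _ ≤ ((p : ℝ) ^ (6 + n) * ‖(z : ℂ)‖ ^ (12 + 2 * n))⁻¹ *
        (C * (((1 + ‖(z : ℂ)‖ ^ 2) / ‖(z : ℂ)‖ ^ 2) ^ n /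
          (z.im / (p * ‖(z : ℂ)‖ ^ 2)) ^ (6 + 2 * n)) *
            Real.exp (-(δ • frickePoint hp z).im)) := by
        gcongr
        refine (h _ δ).trans ?_
        rw [im_frickePoint]
        gcongr
    _ = _ := by
      rw [div_pow, div_pow, mul_pow, ← pow_mul, ← pow_mul]
      field_simp
      ring

end Construction

/-! ### Exponential decay and the twist relation -/

section Properties
open EisensteinSeries Filter Topology
open scoped Manifold

/-- A holomorphic function of period `1` on the upper half-plane which decays exponentially at
infinity and, along vertical lines, at all rational numbers with denominator prime to `p`. -/
structure IsRapid (p : ℕ) (f : ℍ → ℂ) : Prop where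
  mdiff : MDifferentiable 𝓘(ℂ) 𝓘(ℂ) f
  periodic : ∀ z, f ((1 : ℝ) +ᵥ z) = f z
  growth : ∃ (C : ℝ) (A n : ℕ), 0 < C ∧
    ∀ z : ℍ, ‖f z‖ ≤ C * ((1 + ‖(z : ℂ)‖ ^ 2) ^ n / z.im ^ A) * Real.exp (-z.im)
  decay : ∀ (q : ℕ) (u : ℤ), 0 < q → q.Coprime p → IsCoprime u q →
    ∃ (C : ℝ) (A n : ℕ) (c : ℝ), 0 < C ∧ 0 < c ∧ ∀ z : ℍ, z.re = u / q →
      ‖f z‖ ≤ C * ((1 + ‖(z : ℂ)‖ ^ 2) ^ n / z.im ^ A) * Real.exp (-(c / z.im))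

lemma exists_bottom_row {c d : ℤ} (h : IsCoprime c d) :
    ∃ δ : SL(2, ℤ), δ 1 0 = c ∧ δ 1 1 = d := by
  obtain ⟨δ, -, hδ⟩ := bottom_row_surj (R := ℤ) (show ![c, d] ∈ {cd : Fin 2 → ℤ | _} from h)
  exact ⟨δ, congrFun hδ 0, congrFun hδ 1⟩

lemma im_smul_eq (δ : SL(2, ℤ)) (z : ℍ) :
    (δ • z).im = z.im / ‖((δ 1 0 : ℤ) : ℂ) * z + (δ 1 1 : ℤ)‖ ^ 2 := by
  rw [ModularGroup.im_smul_eq_div_normSq, ModularGroup.denom_apply, Complex.normSq_eq_norm_sq]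

lemma norm_mul_sub_of_re_eq {q : ℕ} (hq : 0 < q) {u : ℤ} {z : ℍ} (hz : z.re = u / q) :
    ‖(q : ℂ) * z - u‖ = q * z.im := by
  have hq0 : (q : ℝ) ≠ 0 := by exact_mod_cast hq.ne'
  have : (q : ℂ) * z - u = (q * z.im : ℝ) * Complex.I := by
    apply Complex.ext
    · simp [hz]; field_simp; simp
    · simp
  have hz := z.im_pos
  rw [this, norm_mul, Complex.norm_I, mul_one, Complex.norm_real,
    Real.norm_of_nonneg (by positivity)]

variable {p : ℕ} (χ : DirichletCharacter ℂ p) (n : ℕ)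

lemma T_zpow_mem (hp : 27 ≤ p) (m : ℤ) : T ^ m ∈ smallSubgroup p :=
  zpow_mem (mem_smallSubgroup (T_mem_Gamma0 p) (by simp [T]) (by simp [T]; omega)) m

lemma lowerUnipotent_mem (hp : 27 ≤ p) (m : ℤ) : lowerUnipotent (p * m) ∈ smallSubgroup p :=
  mem_smallSubgroup (lowerUnipotent_mem_Gamma0 m) (by simp [lowerUnipotent])
    (by simp [lowerUnipotent]; omega)

variable {n}

/-- Decay at `u / q` comes from an element of `SL(2, ℤ)` with bottom row `(q, -u)`, which need
not lie in `smallSubgroup p`: only the discriminant has to transform under it. -/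
theorem isRapid_smallCuspForm (hp : 27 ≤ p) (hn : 2 ≤ n) : IsRapid p (smallCuspForm χ n) := by
  obtain ⟨C, hC, hb⟩ := exists_smallCuspForm_bound χ hn
  refine ⟨mdifferentiable_smallCuspForm χ hn, fun z => ?_, ⟨C, 6 + 2 * n, n, hC, fun z => ?_⟩,
    fun q u hq hqp hu => ⟨C, 6 + 2 * n, n, 1 / (q : ℝ) ^ 2, hC, by positivity, fun z hz => ?_⟩⟩
  · have hT : T ∈ smallSubgroup p := by simpa using T_zpow_mem hp 1
    have := smallCuspForm_smul χ n hT z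
    rw [ModularGroup.denom_apply, modular_T_smul] at this
    rw [this]
    simp [T]
  · simpa using hb z 1
  · obtain ⟨δ, h0, h1⟩ := exists_bottom_row (c := (q : ℤ)) (d := -u) hu.symm.neg_right
    have him := im_smul_eq δ z
    rw [h0, h1] at him
    push_cast at him
    rw [← sub_eq_add_neg, norm_mul_sub_of_re_eq hq hz] at him
    have hz0 := z.im_pos
    have hq0 : (0 : ℝ) < q := by exact_mod_cast hq
    have : (δ • z).im = 1 / (q : ℝ) ^ 2 / z.im := by rw [him]; field_simp
    rw [← this]
    exact hb z δ

/-- The Fricke involution conjugates `z ↦ z + 1` to a lower unipotent element of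
`smallSubgroup p`, which gives the period; decay at `u / q` comes from an element of `SL(2, ℤ)`
with bottom row `(p u, q)`, hence the condition that `q` be prime to `p`. -/
theorem isRapid_frickeTransform (hp : 27 ≤ p) (hn : 2 ≤ n) :
    IsRapid p (frickeTransform χ n (p := p) (by omega)) := by
  have hp0 : 0 < p := by omega
  have hpR : (1 : ℝ) ≤ p := by exact_mod_cast hp0
  obtain ⟨C, hC, hb⟩ := exists_frickeTransform_bound χ hp0 hn
  refine ⟨mdifferentiable_frickeTransform χ hp0 hn, fun z => ?_,
    ⟨C, 6 + 2 * n, n, hC, fun z => ?_⟩,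
    fun q u hq hqp hu => ⟨C, 6 + 2 * n, n, 1 / (p * (q : ℝ) ^ 2), hC, by positivity,
      fun z hz => ?_⟩⟩
  · have hL : lowerUnipotent (p * (-1)) ∈ smallSubgroup p := lowerUnipotent_mem hp (-1)
    have h := smallCuspForm_smul χ n hL (frickePoint hp0 z)
    have hpc : (p : ℂ) ≠ 0 := by exact_mod_cast hp0.ne'
    have hz0 : (z : ℂ) ≠ 0 := z.ne_zero
    have hz1 : 1 + (z : ℂ) ≠ 0 := by
      have := ((1 : ℝ) +ᵥ z).ne_zero
      rwa [coe_vadd, Complex.ofReal_one] at this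
    have e : lowerUnipotent (p * (-1)) • frickePoint hp0 z = frickePoint hp0 ((1 : ℝ) +ᵥ z) := by
      ext1
      rw [coe_specialLinearGroup_apply, coe_frickePoint, coe_frickePoint, coe_vadd]
      simp [lowerUnipotent]
      field_simp
    rw [e, ModularGroup.denom_apply, coe_frickePoint] at h
    rw [frickeTransform, frickeTransform, h, coe_vadd]
    have hd : ((lowerUnipotent (p * (-1)) 1 0 : ℤ) : ℂ) * (-1 / (p * z)) +
        (lowerUnipotent (p * (-1)) 1 1 : ℤ) = (1 + z) / z := by
      simp [lowerUnipotent]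
      field_simp
    rw [hd]
    have hχ : χ (lowerUnipotent (p * (-1)) 1 1 : ℤ) = 1 := by simp [lowerUnipotent]
    rw [hχ, div_pow]
    push_cast
    field_simp
  · refine (hb z S).trans ?_
    have hz := z.im_pos
    have hzn : 0 < ‖(z : ℂ)‖ := norm_pos_iff.2 z.ne_zero
    gcongr
    rw [im_smul_eq, im_frickePoint, coe_frickePoint]
    simp only [S, Matrix.of_apply, Matrix.cons_val', Matrix.cons_val_zero, Matrix.cons_val_one,
      Int.cast_one, one_mul, Int.cast_zero, add_zero, norm_div, norm_neg, norm_one, norm_mul,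
      Complex.norm_natCast, Matrix.cons_val_fin_one, Matrix.SpecialLinearGroup.coe_mk]
    rw [le_div_iff₀ (by positivity), div_pow, one_pow, mul_one_div,
      div_le_div_iff₀ (by positivity) (by positivity)]
    have : z.im * ((p : ℝ) * ‖(z : ℂ)‖ ^ 2) ≤ z.im * (p * ‖(z : ℂ)‖) ^ 2 := by
      rw [mul_pow]; gcongr; nlinarith
    exact this
  · have hcop : IsCoprime ((p : ℤ) * u) (q : ℤ) :=
      IsCoprime.mul_left (Nat.isCoprime_iff_coprime.2 hqp.symm) hu
    obtain ⟨δ, h0, h1⟩ := exists_bottom_row hcop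
    have him := im_smul_eq δ (frickePoint hp0 z)
    have hz0 := z.im_pos
    have hq0 : (0 : ℝ) < q := by exact_mod_cast hq
    have hzc : (z : ℂ) ≠ 0 := z.ne_zero
    have hpc : (p : ℂ) ≠ 0 := by exact_mod_cast hp0.ne'
    have hzn : 0 < ‖(z : ℂ)‖ := norm_pos_iff.2 hzc
    rw [h0, h1, coe_frickePoint, im_frickePoint] at him
    have e : (((p : ℤ) * u : ℤ) : ℂ) * (-1 / (p * z)) + ((q : ℤ) : ℂ) = (q * z - u) / z := by
      push_cast; field_simp; ring
    rw [e, norm_div, norm_mul_sub_of_re_eq hq hz] at him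
    have : (δ • frickePoint hp0 z).im = 1 / (p * (q : ℝ) ^ 2) / z.im := by
      rw [him]; field_simp
    rw [← this]
    exact hb z δ

/-- The relation between the two forms behind the functional equations of twists by characters
modulo `q`. It holds because the matrix with rows `((1 + p u v) / q, u)` and `(p v, q)` belongs
to `smallSubgroup p`. -/
theorem smallCuspForm_twist_relation (hp : 27 ≤ p) {q : ℕ} (hq : 0 < q)
    (hqp : 3 * (q : ℤ) ^ 2 ≤ p - 24) {u v : ℤ} (huv : (q : ℤ) ∣ p * u * v + 1) (z A B : ℍ)
    (hA : (A : ℂ) = u / q - 1 / (p * q ^ 2 * z)) (hB : (B : ℂ) = z + v / q) :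
    smallCuspForm χ n A = χ (q : ZMod p) * (q * z) ^ (12 + 2 * n) * (p : ℂ) ^ (6 + n) *
      frickeTransform χ n (p := p) (by omega) B := by
  have hp0 : 0 < p := by omega
  obtain ⟨a, ha⟩ := huv
  let γ : SL(2, ℤ) := ⟨!![a, u; p * v, q], by rw [Matrix.det_fin_two_of]; linarith⟩
  have hγ : γ ∈ smallSubgroup p := by
    refine mem_smallSubgroup ?_ ?_ ?_
    · rw [Gamma0_mem]; simp [γ]
    · simp [γ]; omega
    · simpa [γ] using hqp
  have hpc : (p : ℂ) ≠ 0 := by exact_mod_cast hp0.ne'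
  have hqc : (q : ℂ) ≠ 0 := by exact_mod_cast hq.ne'
  have hz : (z : ℂ) ≠ 0 := z.ne_zero
  have hB0 : (B : ℂ) ≠ 0 := B.ne_zero
  have hac : (a : ℂ) = (p * u * v + 1) / q := by
    rw [eq_div_iff hqc, mul_comm]; exact_mod_cast ha.symm
  have hB' : (q : ℂ) * z = q * B - v := by rw [hB]; field_simp; ring
  have hden : ((γ 1 0 : ℤ) : ℂ) * frickePoint hp0 B + (γ 1 1 : ℤ) = q * z / B := by
    rw [coe_frickePoint, hB']; simp [γ]; field_simp; ring
  have e : A = γ • frickePoint hp0 B := by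
    ext1
    have h1 : ((frickePoint hp0 B : ℍ) : ℂ) = -1 / (p * B) := rfl
    have h2 : (((γ • frickePoint hp0 B : ℍ)) : ℂ) =
        (((γ 0 0 : ℤ) : ℂ) * frickePoint hp0 B + (γ 0 1 : ℤ)) / (q * z / B) := by
      rw [← hden, coe_specialLinearGroup_apply]; simp
    rw [h2, hA, h1]
    have h3 : ((γ 0 0 : ℤ) : ℂ) = (p * u * v + 1) / q := hac
    have h4 : ((γ 0 1 : ℤ) : ℂ) = u := rfl
    have hzB : (z : ℂ) = B - v / q := by rw [hB]; ring
    rw [h3, h4]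
    have hne : (q : ℂ) * B - v ≠ 0 := by rw [← hB']; exact mul_ne_zero hqc hz
    rw [div_div_eq_mul_div, div_sub_div _ _ hqc (by positivity),
      div_eq_div_iff (by positivity) (by positivity)]
    field_simp
    rw [hB]
    field_simp
    ring
  rw [e, smallCuspForm_smul χ n hγ, smallCuspForm_frickePoint, ModularGroup.denom_apply, hden,
    div_pow]
  have h5 : ((γ 1 1 : ℤ) : ZMod p) = q := by simp [γ]
  rw [h5]
  field_simp

end Properties

/-! ### Failure of modularity for principal congruence subgroups -/

section NotClassical
open EisensteinSeries Filter Topology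

variable {p : ℕ} (χ : DirichletCharacter ℂ p) {n : ℕ}

lemma mem_of_lower_left_eq_zero (hp : 27 ≤ p) {δ : SL(2, ℤ)} (h : δ 1 0 = 0) :
    (δ 1 1 = 1 ∨ δ 1 1 = -1) ∧ δ ∈ smallSubgroup p := by
  have hdet := δ.det_coe
  rw [Matrix.det_fin_two, h, mul_zero, sub_zero] at hdet
  rcases Int.mul_eq_one_iff_eq_one_or_neg_one.1 hdet with ⟨h0, h1⟩ | ⟨h0, h1⟩
  · refine ⟨Or.inl h1, ?_⟩
    have : δ = T ^ (δ 0 1) := by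
      ext i j
      rw [coe_T_zpow]
      fin_cases i <;> fin_cases j <;> simp [h, h0, h1]
    rw [this]
    exact T_zpow_mem hp _
  · refine ⟨Or.inr h1, ?_⟩
    have : δ = -1 * T ^ (-δ 0 1) := by
      ext i j
      rw [neg_one_mul, Matrix.SpecialLinearGroup.coe_neg, coe_T_zpow]
      fin_cases i <;> fin_cases j <;> simp [h, h0, h1]
    rw [this]
    exact mul_mem (neg_one_mem_smallSubgroup p) (T_zpow_mem hp _)

/-- The constant term of the Eisenstein series comes from the rows `(0, 1)` and `(0, -1)`. -/
lemma tsum_rowCoeff_constant_term (hχ : χ.Even) (hp : 27 ≤ p) :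
    (∑' v, rowCoeff p χ v * if Matrix.vecMul v ((1 : SL(2, ℤ)) : Matrix (Fin 2) (Fin 2) ℤ) 0 = 0
      then ((Matrix.vecMul v ((1 : SL(2, ℤ)) : Matrix (Fin 2) (Fin 2) ℤ) 1 : ℤ) : ℂ) ^
        (-((2 * n : ℕ) : ℤ)) else 0) = 2 := by
  simp only [Matrix.SpecialLinearGroup.coe_one, Matrix.vecMul_one]
  have hne : ![(0 : ℤ), 1] ≠ ![0, -1] := fun h => by simpa using congrFun h 1
  rw [tsum_eq_sum (s := {![0, 1], ![0, -1]}), Finset.sum_pair hne]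
  · have h1 : ![(0 : ℤ), 1] ∈ rowSet p := ⟨1, one_mem _, by ext i; fin_cases i <;> rfl⟩
    have h2 : ![(0 : ℤ), -1] ∈ rowSet p :=
      ⟨-1, neg_one_mem_smallSubgroup p, by ext i; fin_cases i <;> rfl⟩
    have h3 : χ⁻¹ (-1) = 1 := by
      rw [MulChar.inv_apply_eq_inv', hχ, inv_one]
    simp [rowCoeff, h1, h2, h3, zpow_neg]
    rw [zpow_mul]; norm_num
  · intro v hv
    by_cases hv' : v ∈ rowSet p
    · rw [if_neg, mul_zero]
      obtain ⟨h, -, rfl⟩ := hv'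
      intro h0
      refine hv ?_
      have h01 : h.1 1 = ![h 1 0, h 1 1] := by
        ext i; fin_cases i <;> rfl
      rw [h01, h0]
      rcases (mem_of_lower_left_eq_zero hp h0).1 with h1 | h1 <;> rw [h1] <;> simp
    · rw [rowCoeff, if_neg hv', zero_mul]

lemma tsum_rowCoeff_constant_term_of_notMem (hp : 27 ≤ p) {γ : SL(2, ℤ)}
    (hγ : γ ∉ smallSubgroup p) :
    (∑' v, rowCoeff p χ v * if Matrix.vecMul v γ.1 0 = 0
      then ((Matrix.vecMul v γ.1 1 : ℤ) : ℂ) ^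
        (-((2 * n : ℕ) : ℤ)) else 0) = 0 := by
  refine (tsum_congr fun v => ?_).trans tsum_zero
  by_cases hv : v ∈ rowSet p
  · rw [if_neg, mul_zero]
    obtain ⟨h, hh, rfl⟩ := hv
    rw [← Matrix.mul_apply_eq_vecMul, ← Matrix.SpecialLinearGroup.coe_mul]
    intro h0
    have := mul_mem (inv_mem hh) (mem_of_lower_left_eq_zero hp h0).2
    rw [inv_mul_cancel_left] at this
    exact hγ this
  · rw [rowCoeff, if_neg hv, zero_mul]

lemma tendsto_smallEisenstein (hχ : χ.Even) (hp : 27 ≤ p) (hn : 2 ≤ n) :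
    Tendsto (fun y => smallEisenstein χ n (imagPoint y)) atTop (𝓝 2) := by
  have := tendsto_tsum_eisSummand (norm_rowCoeff_le p χ) hn 1
  rw [tsum_rowCoeff_constant_term χ hχ hp] at this
  simp only [Matrix.SpecialLinearGroup.coe_one, Matrix.vecMul_one] at this
  exact this

lemma exists_smallCuspForm_ne_zero (hχ : χ.Even) (hp : 27 ≤ p) (hn : 2 ≤ n) :
    ∃ y : ℝ, 0 < y ∧ smallCuspForm χ n (imagPoint y) ≠ 0 := by
  obtain ⟨y, hy, hy0⟩ := (((tendsto_smallEisenstein χ hχ hp hn).eventually_ne two_ne_zero).and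
    (eventually_gt_atTop 0)).exists
  exact ⟨y, hy0, mul_ne_zero (ModularForm.discriminant_ne_zero _) hy⟩

/-- The cusp form `smallCuspForm χ n` is not modular of its own weight for any `Γ(N)`: otherwise
the Eisenstein factor would be invariant under `Γ(N)`, but its constant term is `2`, whereas the
constant term of its transform under `γ` vanishes for `γ ∉ smallSubgroup p`. -/
theorem smallCuspForm_not_invariant (hpp : p.Prime) (hχ : χ.Even) (hp : 27 ≤ p) (hn : 2 ≤ n)
    {N : ℕ} (hN : 0 < N) :
    ¬ ∀ γ ∈ Gamma N, ∀ z, smallCuspForm χ n (γ • z) =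
      denom γ z ^ (12 + 2 * n) * smallCuspForm χ n z := by
  intro h
  refine not_Gamma_le_smallSubgroup hpp (by omega) N hN fun γ hγN => ?_
  by_contra hγ
  have h1 := tendsto_tsum_eisSummand (norm_rowCoeff_le p χ) hn γ
  rw [tsum_rowCoeff_constant_term_of_notMem χ hp hγ] at h1
  refine two_ne_zero
    (tendsto_nhds_unique ((tendsto_smallEisenstein χ hχ hp hn).congr fun y => ?_) h1)
  have h2 := h γ hγN (imagPoint y)
  have h3 := denom_ne_zero (γ : GL (Fin 2) ℝ) (imagPoint y)
  rw [smallCuspForm, smallCuspForm, discriminant_smul, smallEisenstein, rowSeries_smul] at h2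
  have h4 := ModularForm.discriminant_ne_zero (imagPoint y)
  have h5 : denom γ (imagPoint y) ^ (12 + 2 * n) * ModularForm.discriminant (imagPoint y) ≠ 0 :=
    mul_ne_zero (pow_ne_zero _ h3) h4
  refine mul_left_cancel₀ h5 ?_
  rw [smallEisenstein, mul_assoc, ← h2]
  ring

lemma eq_zero_of_zpow_eq_one {x : ℂ} (hx : 1 < ‖x‖) {m : ℤ} (h : x ^ m = 1) : m = 0 := by
  have := congrArg norm h
  rw [norm_zpow, norm_one] at this
  exact (zpow_eq_one_iff_right₀ (by positivity) hx.ne').1 this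

lemma IsClassicalCuspForm.exists_invariant {h : ℍ → ℂ} (hh : IsClassicalCuspForm h) :
    ∃ (l : ℤ) (N : ℕ), 0 < N ∧ ∀ γ ∈ Gamma N, ∀ z, h (γ • z) = denom γ z ^ l * h z := by
  obtain ⟨l, N, hN, F, hF⟩ := hh
  refine ⟨l, N, hN, fun γ hγ z => ?_⟩
  rw [← hF, ← hF]
  exact SlashInvariantForm.slash_action_eqn_SL'' F hγ z

theorem not_isClassicalCuspForm_smallCuspForm (hpp : p.Prime) (hχ : χ.Even) (hp : 27 ≤ p)
    (hn : 2 ≤ n) : ¬ IsClassicalCuspForm (smallCuspForm χ n) := by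
  intro h
  obtain ⟨l, N, hN, h⟩ := h.exists_invariant
  obtain ⟨y, hy, hy0⟩ := exists_smallCuspForm_ne_zero χ hχ hp hn
  -- compare the two weights on a lower unipotent element
  have hmem : lowerUnipotent (p * N) ∈ Gamma N := by
    rw [Gamma_mem]; simp [lowerUnipotent]
  have h1 := h _ hmem (imagPoint y)
  rw [smallCuspForm_smul χ n (lowerUnipotent_mem hp N)] at h1
  have hχ1 : χ (lowerUnipotent (p * N) 1 1 : ℤ) = 1 := by simp [lowerUnipotent]
  rw [hχ1, one_mul] at h1
  have h2 := mul_right_cancel₀ hy0 h1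
  set x := denom (lowerUnipotent (p * N)) (imagPoint y) with hx
  have hx0 : x ≠ 0 := denom_ne_zero _ _
  have hxnorm : 1 < ‖x‖ := by
    have : x = 1 + (p * N * y : ℝ) * Complex.I := by
      rw [hx, ModularGroup.denom_apply, coe_imagPoint hy]
      simp [lowerUnipotent]; ring
    have hpos : 0 < (p * N * y : ℝ) := by
      have : (0 : ℝ) < p := by exact_mod_cast hpp.pos
      have : (0 : ℝ) < N := by exact_mod_cast hN
      positivity
    refine lt_of_pow_lt_pow_left₀ 2 (norm_nonneg _) ?_
    rw [this, Complex.sq_norm, Complex.normSq_apply]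
    simp
    exact ⟨⟨hpp.ne_zero, hN.ne'⟩, hy.ne'⟩
  have hl : l - (12 + 2 * n : ℕ) = 0 := by
    refine eq_zero_of_zpow_eq_one hxnorm ?_
    rw [zpow_sub₀ hx0, ← h2, zpow_natCast, div_self (pow_ne_zero _ hx0)]
  obtain rfl : l = (12 + 2 * n : ℕ) := by omega
  exact smallCuspForm_not_invariant χ hpp hχ hp hn hN fun γ hγ z => by
    rw [h γ hγ z, zpow_natCast]

/-- Conjugation by the Fricke involution turns invariance of `frickeTransform` under `Γ(N)` into
invariance of `smallCuspForm` under `Γ(p N)`, up to a factor that is trivial if the weight is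
`12 + 2 n`. -/
theorem not_isClassicalCuspForm_frickeTransform (hpp : p.Prime) (hχ : χ.Even) (hp : 27 ≤ p)
    (hn : 2 ≤ n) : ¬ IsClassicalCuspForm (frickeTransform χ n (p := p) (by omega)) := by
  intro h
  have hp0 : 0 < p := by omega
  have hpc : (p : ℂ) ≠ 0 := by exact_mod_cast hp0.ne'
  obtain ⟨l, N, hN, h⟩ := h.exists_invariant
  obtain ⟨y, hy, hy0⟩ := exists_smallCuspForm_ne_zero χ hχ hp hn
  -- conjugation by the Fricke involution carries `Γ(pN)` into `Γ(N)`
  have key : ∀ γ ∈ Gamma (p * N), ∀ z : ℍ, smallCuspForm χ n (γ • z) =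
      denom γ z ^ (12 + 2 * n) *
        ((((γ 0 0 : ℤ) : ℂ) * z + (γ 0 1 : ℤ)) / z) ^ (l - (12 + 2 * n : ℕ)) *
          smallCuspForm χ n z := by
    intro γ hγ z
    have hz : (z : ℂ) ≠ 0 := z.ne_zero
    have hdet := γ.det_coe
    rw [Matrix.det_fin_two] at hdet
    rw [Gamma_mem] at hγ
    obtain ⟨g00, g01, g10, g11⟩ := hγ
    have hdvd {m : ℤ} {x : ZMod (p * N)} (hm : (m : ZMod (p * N)) = x) :
        (m : ZMod N) = ZMod.castHom (dvd_mul_left N p) (ZMod N) x := by rw [← hm]; simp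
    obtain ⟨c, hc⟩ := (ZMod.intCast_zmod_eq_zero_iff_dvd _ _).1 g10
    have hc' : γ 1 0 = p * (N * c) := by rw [hc]; push_cast; ring
    let γ' : SL(2, ℤ) := ⟨!![γ 1 1, -(N * c); -p * γ 0 1, γ 0 0], by
      rw [Matrix.det_fin_two_of]; rw [hc'] at hdet; linarith⟩
    have hγ' : γ' ∈ Gamma N := by
      rw [Gamma_mem]
      refine ⟨?_, ?_, ?_, ?_⟩
      · simpa [γ'] using hdvd g11
      · simp [γ']
      · have := hdvd g01
        simp only [map_zero] at this
        simp [γ', this]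
      · simpa [γ'] using hdvd g00
    have hnum : ((γ 0 0 : ℤ) : ℂ) * z + (γ 0 1 : ℤ) ≠ 0 := by
      have h1 := (γ • z).ne_zero
      rw [coe_specialLinearGroup_apply] at h1
      simpa using (div_ne_zero_iff.1 h1).1
    have hden0 : ((γ 1 0 : ℤ) : ℂ) * z + (γ 1 1 : ℤ) ≠ 0 := by
      rw [← ModularGroup.denom_apply]; exact denom_ne_zero _ _
    set w := frickePoint hp0 z with hw
    have hwc : (w : ℂ) = -1 / (p * z) := rfl
    have hww : frickePoint hp0 w = z := by
      ext1; rw [coe_frickePoint, hwc]; field_simp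
    have hdenw : denom γ' w = (((γ 0 0 : ℤ) : ℂ) * z + (γ 0 1 : ℤ)) / z := by
      rw [ModularGroup.denom_apply, hwc]
      simp [γ']
      field_simp
      ring
    have hcoe : ((γ' • w : ℍ) : ℂ) =
        -(((γ 1 0 : ℤ) : ℂ) * z + (γ 1 1 : ℤ)) / (p * (((γ 0 0 : ℤ) : ℂ) * z + (γ 0 1 : ℤ))) := by
      have h1 : ((γ' • w : ℍ) : ℂ) =
          (((γ' 0 0 : ℤ) : ℂ) * w + (γ' 0 1 : ℤ)) /
            ((((γ 0 0 : ℤ) : ℂ) * z + (γ 0 1 : ℤ)) / z) := by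
        rw [← hdenw, ModularGroup.denom_apply, coe_specialLinearGroup_apply]; simp
      rw [h1, hc', hwc]
      simp only [γ', Matrix.of_apply, Matrix.cons_val', Matrix.cons_val_zero,
        Matrix.cons_val_one, Matrix.cons_val_fin_one]
      push_cast
      field_simp
      ring
    have hfr : frickePoint hp0 (γ' • w) = γ • z := by
      ext1
      rw [coe_frickePoint, hcoe, coe_specialLinearGroup_apply]
      simp only [algebraMap_int_eq, eq_intCast, Complex.ofReal_intCast]
      field_simp
    have h1 := smallCuspForm_frickePoint χ n hp0 (γ' • w)
    have h2 := smallCuspForm_frickePoint χ n hp0 w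
    rw [hww] at h2
    rw [hfr, h γ' hγ' w, hdenw, hcoe] at h1
    have hq : (((γ 0 0 : ℤ) : ℂ) * z + (γ 0 1 : ℤ)) / (z : ℂ) ≠ 0 := div_ne_zero hnum hz
    rw [h1, h2, ModularGroup.denom_apply, zpow_sub₀ hq, zpow_natCast, hwc]
    have hK : Even (12 + 2 * n) := ⟨6 + n, by ring⟩
    rw [div_pow, div_pow, div_pow, hK.neg_pow, hK.neg_pow, one_pow, mul_pow, mul_pow]
    generalize 12 + 2 * n = K
    field_simp
  -- compare the two weights on a translation
  have hmem : T ^ ((p * N : ℕ) : ℤ) ∈ Gamma (p * N) := by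
    rw [Gamma_mem, coe_T_zpow]; simp; exact_mod_cast ZMod.natCast_self (p * N)
  have h1 := key _ hmem (imagPoint y)
  have hT := smallCuspForm_smul χ n (T_zpow_mem hp ((p * N : ℕ) : ℤ)) (imagPoint y)
  have hχ1 : χ ((T ^ ((p * N : ℕ) : ℤ) : SL(2, ℤ)) 1 1 : ℤ) = 1 := by
    rw [coe_T_zpow]; simp
  have hden0 := denom_ne_zero ((T ^ ((p * N : ℕ) : ℤ) : SL(2, ℤ)) : GL (Fin 2) ℝ) (imagPoint y)
  rw [hT, hχ1, one_mul] at h1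
  have h2 := mul_right_cancel₀ hy0 h1
  have h3 := (mul_eq_left₀ (pow_ne_zero (12 + 2 * n) hden0)).1 h2.symm
  have hl : l - (12 + 2 * n : ℕ) = 0 := by
    refine eq_zero_of_zpow_eq_one ?_ h3
    rw [coe_T_zpow, norm_div, one_lt_div (norm_pos_iff.2 (ne_zero _)), coe_imagPoint hy]
    refine lt_of_pow_lt_pow_left₀ 2 (norm_nonneg _) ?_
    rw [Complex.sq_norm, Complex.normSq_apply, Complex.sq_norm, Complex.normSq_apply]
    simp
    exact ⟨hpp.ne_zero, hN.ne'⟩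
  exact smallCuspForm_not_invariant χ hpp hχ hp hn (N := p * N) (by positivity) fun γ hγ z => by
    rw [key γ hγ z, hl, zpow_zero, mul_one]

end NotClassical

/-! ### Fourier coefficients and Mellin transforms -/

section QExpansion
open Filter Topology Asymptotics
open scoped Manifold

variable {p : ℕ} {f : ℍ → ℂ}

lemma IsRapid.periodic_int (hf : IsRapid p f) (m : ℤ) (z : ℍ) : f ((m : ℝ) +ᵥ z) = f z := by
  induction m with
  | zero => simp
  | succ i ih =>
    have : (((i : ℤ) + 1 : ℤ) : ℝ) +ᵥ z = (1 : ℝ) +ᵥ (((i : ℤ) : ℝ) +ᵥ z) := by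
      rw [vadd_vadd]; push_cast; rw [add_comm]
    rw [this, hf.periodic, ih]
  | pred i ih =>
    rw [← hf.periodic, vadd_vadd, ← ih]
    congr 2
    push_cast; ring

/-- By periodicity, the growth bound may be evaluated at the translate with real part in
`[0, 1)`. -/
lemma IsRapid.exists_uniform_growth (hf : IsRapid p f) : ∃ (C : ℝ) (A n : ℕ), 0 < C ∧
    ∀ z : ℍ, ‖f z‖ ≤ C * ((2 + z.im ^ 2) ^ n / z.im ^ A) * Real.exp (-z.im) := by
  obtain ⟨C, A, n, hC, h⟩ := hf.growth
  refine ⟨C, A, n, hC, fun z => ?_⟩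
  have hz := z.im_pos
  have h1 := h (((-⌊z.re⌋ : ℤ) : ℝ) +ᵥ z)
  rw [hf.periodic_int, vadd_im] at h1
  have h2 := Int.floor_le z.re
  have h3 := Int.lt_floor_add_one z.re
  have h4 : 1 + ‖((((-⌊z.re⌋ : ℤ) : ℝ) +ᵥ z : ℍ) : ℂ)‖ ^ 2 ≤ 2 + z.im ^ 2 := by
    rw [Complex.sq_norm, Complex.normSq_apply, coe_im, coe_re, vadd_im, vadd_re]
    push_cast
    nlinarith
  refine h1.trans ?_
  gcongr

lemma IsRapid.periodic_ofComplex (hf : IsRapid p f) :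
    Function.Periodic (f ∘ ofComplex) ((1 : ℝ) : ℂ) := by
  intro w
  simp only [Function.comp]
  by_cases hw : 0 < w.im
  · have hw' : 0 < (w + (1 : ℝ)).im := by simpa using hw
    rw [ofComplex_apply_of_im_pos hw, ofComplex_apply_of_im_pos hw', ← hf.periodic ⟨w, hw⟩]
    congr 1
    ext1
    rw [coe_vadd]
    exact add_comm _ _
  · exact congrArg f (ofComplex_apply_eq_of_im_nonpos (by simpa using hw) (not_lt.1 hw))

lemma IsRapid.isZeroAtImInfty (hf : IsRapid p f) : IsZeroAtImInfty f := by
  obtain ⟨C, A, n, hC, h⟩ := hf.exists_uniform_growth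
  have h1 : Tendsto (fun y : ℝ => C * 3 ^ n * (y ^ (2 * n) * Real.exp (-y))) atTop (𝓝 0) := by
    simpa using (Real.tendsto_pow_mul_exp_neg_atTop_nhds_zero (2 * n)).const_mul (C * 3 ^ n)
  refine squeeze_zero_norm' ?_ (h1.comp (tendsto_comap (f := UpperHalfPlane.im)))
  have h2 : ∀ᶠ z : ℍ in atImInfty, 1 ≤ z.im := tendsto_comap.eventually (eventually_ge_atTop 1)
  filter_upwards [h2] with z hz
  refine (h z).trans ?_
  simp only [Function.comp]
  have h5 : 2 + z.im ^ 2 ≤ 3 * z.im ^ 2 := by nlinarith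
  have h6 : (2 + z.im ^ 2) ^ n / z.im ^ A ≤ (3 * z.im ^ 2) ^ n :=
    (div_le_self (by positivity) (one_le_pow₀ hz)).trans (by gcongr)
  calc _ ≤ C * (3 * z.im ^ 2) ^ n * Real.exp (-z.im) := by gcongr
    _ = _ := by rw [mul_pow]; ring

/-- The Fourier coefficients of `f`. -/
def qCoeff (f : ℍ → ℂ) (m : ℕ) : ℂ := (qExpansion 1 f).coeff m

lemma IsRapid.hasSum_qCoeff (hf : IsRapid p f) (z : ℍ) :
    HasSum (fun m : ℕ => qCoeff f m * Complex.exp (2 * Real.pi * Complex.I * m * z))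
      (f z) := by
  have h := hasSum_qExpansion one_pos hf.periodic_ofComplex hf.mdiff
    hf.isZeroAtImInfty.isBoundedAtImInfty z
  refine h.congr_fun fun m => ?_
  rw [smul_eq_mul, qCoeff, Function.Periodic.qParam, ← Complex.exp_nat_mul]
  congr 2
  push_cast; ring

lemma IsRapid.qCoeff_zero (hf : IsRapid p f) : qCoeff f 0 = 0 := by
  rw [qCoeff, qExpansion_coeff]
  simp [hf.isZeroAtImInfty.cuspFunction_apply_zero one_pos]

theorem IsRapid.qSeries_qCoeff (hf : IsRapid p f) : qSeries (qCoeff f) = f := by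
  ext z
  have h := hf.hasSum_qCoeff z
  rw [qSeries, ← h.tsum_eq, tsum_pnat_eq_tsum_succ
    (f := fun m : ℕ => qCoeff f m * Complex.exp (2 * Real.pi * Complex.I * m * z)),
    h.summable.tsum_eq_zero_add, hf.qCoeff_zero]
  simp

theorem IsRapid.exists_qCoeff_bound (hf : IsRapid p f) :
    ∃ (C : ℝ) (A : ℕ), 0 < C ∧ ∀ m : ℕ, 0 < m → ‖qCoeff f m‖ ≤ C * (m : ℝ) ^ A := by
  obtain ⟨C, A, n, hC, h⟩ := hf.exists_uniform_growth
  refine ⟨Real.exp (2 * Real.pi) * (C * 3 ^ n), A, by positivity, fun m hm => ?_⟩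
  have hm0 : (0 : ℝ) < m := by exact_mod_cast hm
  have hm1 : (1 : ℝ) ≤ m := by exact_mod_cast hm
  -- Cauchy's estimate at height `1 / m`
  have ht : (0 : ℝ) < 1 / m := by positivity
  rw [qCoeff, qExpansion_coeff_eq_intervalIntegral one_pos hf.periodic_ofComplex hf.mdiff
    hf.isZeroAtImInfty.isBoundedAtImInfty m ht]
  simp only [Complex.ofReal_one, div_one, one_mul]
  refine (intervalIntegral.norm_integral_le_of_norm_le_const
    (C := Real.exp (2 * Real.pi) * (C * 3 ^ n) * (m : ℝ) ^ A) fun u _ => ?_).trans (by simp)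
  rw [norm_mul, norm_div, norm_one, norm_pow, Function.Periodic.norm_qParam, ← Real.exp_nat_mul,
    one_div, ← Real.exp_neg, mul_assoc (Real.exp (2 * Real.pi))]
  set z : ℍ := ⟨u + (1 / m : ℝ) * (UpperHalfPlane.I : ℂ), by simpa using ht⟩ with hz
  have him : z.im = 1 / m := by rw [← coe_im]; simp [hz]
  have h1 := h z
  rw [him] at h1
  refine mul_le_mul (Real.exp_le_exp.2 (le_of_eq ?_)) (h1.trans ?_) (norm_nonneg _) (by positivity)
  · simp; field_simp
  · calc C * ((2 + (1 / (m : ℝ)) ^ 2) ^ n / (1 / (m : ℝ)) ^ A) * Real.exp (-(1 / m))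
        ≤ C * (3 ^ n / (1 / (m : ℝ)) ^ A) * 1 := by
          gcongr
          · have : (1 / (m : ℝ)) ^ 2 ≤ 1 := pow_le_one₀ ht.le (by rw [div_le_one hm0]; exact hm1)
            linarith
          · rw [Real.exp_le_one_iff]; linarith
      _ = C * 3 ^ n * (m : ℝ) ^ A := by rw [one_div, inv_pow]; field_simp

end QExpansion

section Mellin
open Filter Topology Asymptotics MeasureTheory Set

/-- A function on the positive half-line that decays faster than any power at `0` and at
infinity. -/
structure IsRapidOnRay (F : ℝ → ℂ) : Prop where
  continuousOn : ContinuousOn F (Ioi 0)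
  top : ∀ a : ℝ, F =O[atTop] (· ^ a : ℝ → ℝ)
  bot : ∀ a : ℝ, F =O[𝓝[>] 0] (· ^ a : ℝ → ℝ)

variable {F : ℝ → ℂ}

lemma IsRapidOnRay.const_mul (hF : IsRapidOnRay F) (c : ℂ) : IsRapidOnRay fun y => c * F y :=
  ⟨hF.continuousOn.const_smul c, fun a => (hF.top a).const_mul_left c,
    fun a => (hF.bot a).const_mul_left c⟩

lemma IsRapidOnRay.sum {ι : Type*} (s : Finset ι) {G : ι → ℝ → ℂ}
    (hG : ∀ i ∈ s, IsRapidOnRay (G i)) : IsRapidOnRay fun y => ∑ i ∈ s, G i y :=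
  ⟨continuousOn_finsetSum _ fun i hi => (hG i hi).continuousOn,
    fun a => IsBigO.fun_sum fun i hi => (hG i hi).top a,
    fun a => IsBigO.fun_sum fun i hi => (hG i hi).bot a⟩

lemma IsRapidOnRay.locallyIntegrableOn (hF : IsRapidOnRay F) : LocallyIntegrableOn F (Ioi 0) :=
  hF.continuousOn.locallyIntegrableOn measurableSet_Ioi

lemma IsRapidOnRay.differentiable_mellin (hF : IsRapidOnRay F) : Differentiable ℂ (mellin F) :=
  fun s => mellin_differentiableAt_of_isBigO_rpow (a := s.re + 1) (b := s.re - 1)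
    hF.locallyIntegrableOn (hF.top _) (by linarith) (hF.bot _) (by linarith)

lemma IsRapidOnRay.mellinConvergent (hF : IsRapidOnRay F) (s : ℂ) : MellinConvergent F s :=
  mellinConvergent_of_isBigO_rpow (a := s.re + 1) (b := s.re - 1)
    hF.locallyIntegrableOn (hF.top _) (by linarith) (hF.bot _) (by linarith)

/-- On `x₁ ≤ re s ≤ x₂` the Mellin integral is dominated by the sum of the absolute integrals
at `x₁` and `x₂`. -/
theorem IsRapidOnRay.boundedInVerticalStrips_mellin (hF : IsRapidOnRay F) :
    BoundedInVerticalStrips (mellin F) := by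
  intro x₁ x₂
  have hint (x : ℝ) : IntegrableOn (fun t : ℝ => t ^ (x - 1) * ‖F t‖) (Ioi 0) := by
    have := (hF.mellinConvergent x).norm
    refine (integrableOn_congr_fun (fun t ht => ?_) measurableSet_Ioi).1 this
    rw [norm_smul, Complex.norm_cpow_eq_rpow_re_of_pos ht]
    simp
  refine ⟨∫ t in Ioi (0 : ℝ), (t ^ (x₁ - 1) * ‖F t‖ + t ^ (x₂ - 1) * ‖F t‖), fun s h₁ h₂ => ?_⟩
  refine norm_integral_le_of_norm_le ((hint x₁).add (hint x₂)) ?_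
  refine (ae_restrict_mem measurableSet_Ioi).mono fun t ht => ?_
  have ht : 0 < t := ht
  rw [norm_smul, Complex.norm_cpow_eq_rpow_re_of_pos ht, Complex.sub_re, Complex.one_re, ← add_mul]
  refine mul_le_mul_of_nonneg_right ?_ (norm_nonneg _)
  rcases le_total 1 t with h | h
  · exact (Real.rpow_le_rpow_of_exponent_le h (by linarith)).trans
      (le_add_of_nonneg_left (by positivity))
  · exact (Real.rpow_le_rpow_of_exponent_ge ht h (by linarith)).trans
      (le_add_of_nonneg_right (by positivity))

lemma isBigO_exp_neg_rpow (B : ℕ) (a : ℝ) :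
    (fun y : ℝ => y ^ B * Real.exp (-y)) =O[atTop] (· ^ a : ℝ → ℝ) := by
  have h := (isLittleO_exp_neg_mul_rpow_atTop one_pos (a - B)).isBigO
  refine ((isBigO_refl (fun y : ℝ => y ^ B) _).mul h).congr' ?_ ?_
  · exact Eventually.of_forall fun y => by simp
  · filter_upwards [eventually_gt_atTop 0] with y hy
    rw [← Real.rpow_natCast, ← Real.rpow_add hy]
    congr 1; ring

/-- The values of `f` along the vertical line through the real number `x`, as a function of the
height `y`; meaningful for `0 < y`. -/
def lineFun (f : ℍ → ℂ) (x : ℝ) (y : ℝ) : ℂ := f (ofComplex (x + y * Complex.I))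

variable {p : ℕ} {f : ℍ → ℂ}

theorem IsRapid.isRapidOnRay (hf : IsRapid p f) {q : ℕ} {u : ℤ} (hq : 0 < q)
    (hqp : q.Coprime p) (hu : IsCoprime u q) : IsRapidOnRay (lineFun f (u / q)) := by
  have hpt {y : ℝ} (hy : 0 < y) :
      (ofComplex (((u / q : ℝ) : ℂ) + y * Complex.I)).re = u / q ∧
      (ofComplex (((u / q : ℝ) : ℂ) + y * Complex.I)).im = y := by
    rw [ofComplex_apply_of_im_pos (by simpa using hy), ← coe_re, ← coe_im]
    constructor
    · rw [Complex.add_re, Complex.ofReal_re]; simp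
    · rw [Complex.add_im, Complex.ofReal_im]; simp
  refine ⟨?_, fun a => ?_, fun a => ?_⟩
  · have h := (UpperHalfPlane.mdifferentiable_iff.1 hf.mdiff).continuousOn
    refine h.comp (f := fun y : ℝ => (((u / q : ℝ) : ℂ) + y * Complex.I)) (by fun_prop) ?_
    intro y hy
    change 0 < (((u / q : ℝ) : ℂ) + y * Complex.I).im
    simpa using hy
  · obtain ⟨C, A, n, hC, h⟩ := hf.exists_uniform_growth
    refine IsBigO.trans ?_ (isBigO_exp_neg_rpow (2 * n) a)
    refine IsBigO.of_bound (C * 3 ^ n) ?_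
    filter_upwards [eventually_ge_atTop 1] with y hy
    have hy0 : 0 < y := by linarith
    have h1 := h (ofComplex (((u / q : ℝ) : ℂ) + y * Complex.I))
    rw [(hpt hy0).2] at h1
    refine h1.trans ?_
    rw [Real.norm_of_nonneg (by positivity)]
    have h5 : 2 + y ^ 2 ≤ 3 * y ^ 2 := by nlinarith
    have h6 : (2 + y ^ 2) ^ n / y ^ A ≤ (3 * y ^ 2) ^ n :=
      (div_le_self (by positivity) (one_le_pow₀ hy)).trans (by gcongr)
    calc _ ≤ C * (3 * y ^ 2) ^ n * Real.exp (-y) := by gcongr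
      _ = _ := by rw [mul_pow]; ring
  · obtain ⟨C, A, n, c, hC, hc, h⟩ := hf.decay q u hq hqp hu
    -- substitute `y ↦ c / y`
    have hlim : Tendsto (fun y : ℝ => c / y) (𝓝[>] 0) atTop := by
      simpa [div_eq_mul_inv] using tendsto_inv_nhdsGT_zero.const_mul_atTop hc
    have h0 := (isBigO_exp_neg_rpow A (-a)).comp_tendsto hlim
    have h2 : (fun y : ℝ => (c / y) ^ (-a)) =O[𝓝[>] 0] (· ^ a : ℝ → ℝ) := by
      refine IsBigO.of_bound (c ^ (-a)) ?_
      filter_upwards [self_mem_nhdsWithin] with y hy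
      have hy : 0 < y := hy
      rw [Real.div_rpow hc.le hy.le, Real.rpow_neg hy.le, div_inv_eq_mul, norm_mul,
        Real.norm_of_nonneg (Real.rpow_nonneg hc.le _)]
    refine IsBigO.trans ?_ (h0.trans h2)
    refine IsBigO.of_bound (C * (2 + (u / q : ℝ) ^ 2) ^ n / c ^ A) ?_
    filter_upwards [Ioo_mem_nhdsGT one_pos] with y hy
    obtain ⟨hy0, hy1⟩ := hy
    have h1 := h (ofComplex (((u / q : ℝ) : ℂ) + y * Complex.I)) (hpt hy0).1
    rw [(hpt hy0).2] at h1
    refine h1.trans ?_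
    simp only [Function.comp]
    have h3 : ‖((ofComplex (((u / q : ℝ) : ℂ) + y * Complex.I) : ℍ) : ℂ)‖ ^ 2 =
        (u / q : ℝ) ^ 2 + y ^ 2 := by
      rw [Complex.sq_norm, Complex.normSq_apply, coe_re, coe_im, (hpt hy0).1, (hpt hy0).2]; ring
    rw [h3, Real.norm_of_nonneg (by positivity), div_pow c]
    calc C * ((1 + ((u / q : ℝ) ^ 2 + y ^ 2)) ^ n / y ^ A) * Real.exp (-(c / y))
        ≤ C * ((2 + (u / q : ℝ) ^ 2) ^ n / y ^ A) * Real.exp (-(c / y)) := by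
          gcongr ?_ * (?_ ^ n / _) * _
          nlinarith
      _ = _ := by
        have := hc.ne'
        have := hy0.ne'
        field_simp

end Mellin

/-! ### Gauss sums and twists -/

section Twists
open Filter Topology Asymptotics MeasureTheory Set
open ZMod (stdAddChar)

section GaussSum

variable {q : ℕ} [NeZero q] {ψ : DirichletCharacter ℂ q}

lemma DirichletCharacter.IsPrimitive.inv {q : ℕ} {ψ : DirichletCharacter ℂ q}
    (hψ : ψ.IsPrimitive) : ψ⁻¹.IsPrimitive := by
  have h {φ : DirichletCharacter ℂ q} {d : ℕ} (hφ : φ.FactorsThrough d) :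
      φ⁻¹.FactorsThrough d := by
    obtain ⟨hd, φ₀, h⟩ := hφ
    exact ⟨hd, φ₀⁻¹, by rw [h, map_inv]⟩
  rw [DirichletCharacter.isPrimitive_def] at hψ ⊢
  refine Eq.trans ?_ hψ
  rw [DirichletCharacter.conductor, DirichletCharacter.conductor]
  congr 1
  ext d
  exact ⟨fun hd => inv_inv ψ ▸ h hd, fun hd => h hd⟩

lemma gaussSum_mul_gaussSum_inv_of_isPrimitive (hψ : ψ.IsPrimitive) :
    gaussSum ψ (stdAddChar (N := q)) * gaussSum ψ⁻¹ (stdAddChar (N := q)) = ψ (-1) * q := by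
  have h (a : ZMod q) : ψ⁻¹ a * stdAddChar a * gaussSum ψ (stdAddChar (N := q)) =
      ∑ x, ψ x * stdAddChar (a * (1 + x)) := by
    rw [mul_right_comm, ← gaussSum_mulShift_of_isPrimitive _ hψ, gaussSum, Finset.sum_mul]
    refine Finset.sum_congr rfl fun x _ => ?_
    rw [AddChar.mulShift_apply, mul_add, mul_one, AddChar.map_add_eq_mul]
    ring
  rw [mul_comm, gaussSum, Finset.sum_mul, Finset.sum_congr rfl fun a _ => h a, Finset.sum_comm]
  simp only [← Finset.mul_sum, AddChar.sum_mulShift _ (ZMod.isPrimitive_stdAddChar q),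
    ZMod.card]
  rw [Finset.sum_eq_single (-1 : ZMod q)]
  · simp
  · intro x _ hx
    rw [if_neg fun h => hx (eq_neg_of_add_eq_zero_right h)]
    simp
  · simp

lemma gaussSum_inv_ne_zero (hψ : ψ.IsPrimitive) :
    gaussSum ψ⁻¹ (stdAddChar (N := q)) ≠ 0 := by
  have h := gaussSum_mul_gaussSum_inv_of_isPrimitive hψ
  intro h0
  rw [h0, mul_zero] at h
  have h1 : ψ (-1) * ψ (-1) = 1 := by rw [← map_mul]; simp
  have h2 : (q : ℂ) ≠ 0 := Nat.cast_ne_zero.2 (NeZero.ne q)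
  rcases mul_eq_zero.1 h.symm with h | h
  · simp [h] at h1
  · exact h2 h

/-- A character sum only sees the units. -/
lemma sum_dirichletCharacter_mul (ψ : DirichletCharacter ℂ q) (h : ZMod q → ℂ) :
    ∑ u, ψ u * h u = ∑ u : (ZMod q)ˣ, ψ u * h u :=
  (Fintype.sum_of_injective (Units.val : (ZMod q)ˣ → ZMod q) Units.val_injective
    (fun u => ψ u * h u) (fun u => ψ u * h u) (fun u hu => by
      rw [MulChar.map_nonunit ψ fun h => hu h, zero_mul]) fun _ => rfl).symm

end GaussSum

/-- The twist by `ψ` of the Fourier series of `f`, on the positive imaginary axis. -/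
def twistRay (f : ℍ → ℂ) {q : ℕ} (ψ : DirichletCharacter ℂ q) (y : ℝ) : ℂ :=
  ∑' m : ℕ, qCoeff f m * ψ m * Real.exp (-(2 * Real.pi * m) * y)

variable {p q : ℕ} {f : ℍ → ℂ} {ψ : DirichletCharacter ℂ q}

lemma ofComplex_re_im {x y : ℝ} (hy : 0 < y) :
    ((ofComplex (x + y * Complex.I) : ℍ) : ℂ) = x + y * Complex.I := by
  rw [ofComplex_apply_of_im_pos (by simpa using hy)]

/-- Averaging over the rational translates `u / q` against `ψ⁻¹` twists the Fourier
coefficients by `ψ`. -/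
lemma IsRapid.hasSum_twistRay [NeZero q] (hf : IsRapid p f) (hψ : ψ.IsPrimitive) {y : ℝ}
    (hy : 0 < y) :
    HasSum (fun m : ℕ => qCoeff f m * ψ m * Real.exp (-(2 * Real.pi * m) * y))
      ((gaussSum ψ⁻¹ (stdAddChar (N := q)))⁻¹ *
        ∑ u : ZMod q, ψ⁻¹ u * lineFun f (((u.val : ℤ) : ℝ) / q) y) := by
  have h := hasSum_sum (s := Finset.univ) fun (u : ZMod q) _ =>
    (hf.hasSum_qCoeff (ofComplex (((((u.val : ℤ) : ℝ) / q : ℝ) : ℂ) + y * Complex.I))).mul_left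
      (ψ⁻¹ u)
  have h0 := h.mul_left (gaussSum ψ⁻¹ (stdAddChar (N := q)))⁻¹
  refine h0.congr_fun fun m => ?_
  have hq : (q : ℂ) ≠ 0 := Nat.cast_ne_zero.2 (NeZero.ne q)
  have hterm (u : ZMod q) : ψ⁻¹ u * (qCoeff f m * Complex.exp (2 * Real.pi * Complex.I * m *
      (ofComplex (((((u.val : ℤ) : ℝ) / q : ℝ) : ℂ) + y * Complex.I) : ℍ))) =
      qCoeff f m * Real.exp (-(2 * Real.pi * m) * y) *
        (ψ⁻¹ u * stdAddChar.mulShift (m : ZMod q) u) := by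
    have h1 : stdAddChar.mulShift (m : ZMod q) u =
        Complex.exp (2 * Real.pi * Complex.I * ((m * u.val : ℤ) : ℂ) / q) := by
      rw [AddChar.mulShift_apply, ← ZMod.stdAddChar_coe]
      push_cast
      rw [ZMod.natCast_zmod_val]
    have h2 : Complex.exp (2 * Real.pi * Complex.I * m *
        (((((u.val : ℤ) : ℝ) / q : ℝ) : ℂ) + y * Complex.I)) =
        Real.exp (-(2 * Real.pi * m) * y) *
          Complex.exp (2 * Real.pi * Complex.I * ((m * u.val : ℤ) : ℂ) / q) := by
      rw [Complex.ofReal_exp, ← Complex.exp_add]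
      congr 1
      push_cast
      linear_combination (2 * Real.pi * m * y : ℂ) * Complex.I_sq
    rw [ofComplex_re_im hy, h1, h2]
    ring
  rw [Finset.sum_congr rfl fun u _ => hterm u, ← Finset.mul_sum]
  change _ = _ * (_ * gaussSum ψ⁻¹ (stdAddChar.mulShift (m : ZMod q)))
  rw [gaussSum_mulShift_of_isPrimitive _ hψ.inv, inv_inv]
  field_simp [gaussSum_inv_ne_zero hψ]

lemma IsRapid.gaussSum_mul_twistRay [NeZero q] (hf : IsRapid p f) (hψ : ψ.IsPrimitive) {y : ℝ}
    (hy : 0 < y) :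
    gaussSum ψ⁻¹ (stdAddChar (N := q)) * twistRay f ψ y =
      ∑ u : ZMod q, ψ⁻¹ u * lineFun f (((u.val : ℤ) : ℝ) / q) y := by
  rw [twistRay, (hf.hasSum_twistRay hψ hy).tsum_eq, mul_inv_cancel_left₀ (gaussSum_inv_ne_zero hψ)]

lemma IsRapidOnRay.congr {F G : ℝ → ℂ} (hF : IsRapidOnRay F) (h : EqOn G F (Ioi 0)) :
    IsRapidOnRay G :=
  ⟨hF.continuousOn.congr h,
    fun a => (hF.top a).congr' ((eventually_gt_atTop 0).mono fun _ hy => (h hy).symm) .rfl,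
    fun a => (hF.bot a).congr' (eventually_mem_nhdsWithin.mono fun _ hy => (h hy).symm) .rfl⟩

lemma IsRapidOnRay.zero : IsRapidOnRay fun _ => 0 :=
  ⟨continuousOn_const, fun _ => isBigO_zero _ _, fun _ => isBigO_zero _ _⟩

theorem IsRapid.isRapidOnRay_twistRay [NeZero q] (hf : IsRapid p f) (hψ : ψ.IsPrimitive)
    (hqp : q.Coprime p) : IsRapidOnRay (twistRay f ψ) := by
  refine IsRapidOnRay.congr ((IsRapidOnRay.sum Finset.univ (G := fun (u : ZMod q) y =>
    ψ⁻¹ u * lineFun f (((u.val : ℤ) : ℝ) / q) y) fun u _ => ?_).const_mul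
      (gaussSum ψ⁻¹ (stdAddChar (N := q)))⁻¹) fun y hy => (hf.hasSum_twistRay hψ hy).tsum_eq
  by_cases hu : IsUnit u
  · refine (hf.isRapidOnRay (NeZero.pos q) hqp ?_).const_mul _
    rw [Nat.isCoprime_iff_coprime]
    simpa using ZMod.val_coe_unit_coprime hu.unit
  · simpa only [MulChar.map_nonunit _ hu, zero_mul] using IsRapidOnRay.zero

/-- In the half-plane of absolute convergence the Mellin transform may be computed term by
term. -/
theorem IsRapid.mellin_twistRay [NeZero q] (hf : IsRapid p f) (hψ : ψ.IsPrimitive) {C : ℝ}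
    {A : ℕ} (hC : ∀ m : ℕ, 0 < m → ‖qCoeff f m‖ ≤ C * (m : ℝ) ^ A) {s : ℂ}
    (hs : A + 1 < s.re) : mellin (twistRay f ψ) s = twistedLambda (qCoeff f) ψ s := by
  have hs0 : 0 < s.re := by have : (0 : ℝ) ≤ A := A.cast_nonneg; linarith
  have hpi : (0 : ℝ) < 2 * Real.pi := by positivity
  have h := hasSum_mellin (a := fun m : ℕ => qCoeff f m * ψ m) (p := fun m => 2 * Real.pi * m)
    (F := twistRay f ψ) (s := s) (fun m => ?_) hs0 (fun y hy => ?_) ?_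
  · rw [← h.tsum_eq, twistedLambda, LSeries, ← tsum_mul_left]
    refine tsum_congr fun m => ?_
    rcases eq_or_ne m 0 with rfl | hm
    · simp [hf.qCoeff_zero]
    · rw [LSeries.term_of_ne_zero hm, Complex.cpow_neg]
      push_cast
      rw [show (2 * Real.pi * m : ℂ) = ((2 * Real.pi : ℝ) : ℂ) * ((m : ℝ) : ℂ) by push_cast; ring,
        Complex.mul_cpow_ofReal_nonneg hpi.le m.cast_nonneg]
      push_cast
      field_simp
  · rcases Nat.eq_zero_or_pos m with rfl | hm
    · simp [hf.qCoeff_zero]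
    · right; positivity
  · exact (hf.hasSum_twistRay hψ hy).summable.hasSum
  · have h1 : Summable fun m : ℕ => C * (2 * Real.pi) ^ (-s.re) * (m : ℝ) ^ (A - s.re) :=
      (Real.summable_nat_rpow.2 (by linarith)).mul_left _
    refine h1.of_norm_bounded_eventually_nat ?_
    filter_upwards [eventually_gt_atTop 0] with m hm
    have hm0 : (0 : ℝ) < m := by exact_mod_cast hm
    rw [Real.norm_of_nonneg (by positivity), Real.mul_rpow hpi.le hm0.le, Real.rpow_neg hpi.le,
      Real.rpow_sub hm0, Real.rpow_natCast]
    have h2 : ‖qCoeff f m * ψ m‖ ≤ C * (m : ℝ) ^ A := by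
      rw [norm_mul]
      exact (mul_le_of_le_one_right (norm_nonneg _) (ψ.norm_le_one _)).trans (hC m hm)
    calc _ ≤ C * (m : ℝ) ^ A / ((2 * Real.pi) ^ s.re * (m : ℝ) ^ s.re) := by gcongr
      _ = _ := by field_simp

end Twists

/-! ### Functional equations -/

section FunctionalEquation
open Filter Topology Asymptotics MeasureTheory Set
open ZMod (stdAddChar)

variable {p q n : ℕ} {χ : DirichletCharacter ℂ p} {ψ : DirichletCharacter ℂ q}

/-- The functional equation before the Mellin transform. The relation between `f` near
`u / q` and `g` near `v / q`, where `p u v ≡ -1` modulo `q`, is averaged over `u`. -/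
theorem twistRay_smallCuspForm [NeZero q] (hp : 27 ≤ p) (hn : 2 ≤ n) (hp0 : 0 < p)
    (hψ : ψ.IsPrimitive) (hqp : q.Coprime p) (hq : 3 * (q : ℤ) ^ 2 ≤ p - 24) {t : ℝ}
    (ht : 0 < t) :
    twistRay (smallCuspForm χ n) ψ ((p * q ^ 2 * t)⁻¹) =
      Complex.I ^ (12 + 2 * n) * χ (q : ZMod p) * ψ (p : ZMod q) *
        (gaussSum ψ (stdAddChar (N := q)) ^ 2 / q) * q ^ (12 + 2 * n) * p ^ (6 + n) *
          ((t : ℂ) ^ (12 + 2 * n) * twistRay (frickeTransform χ n (p := p) hp0) ψ⁻¹ t) := by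
  have hq0 : 0 < q := NeZero.pos q
  have hqC : (q : ℂ) ≠ 0 := Nat.cast_ne_zero.2 hq0.ne'
  have hpC : (p : ℂ) ≠ 0 := Nat.cast_ne_zero.2 hp0.ne'
  have hf := isRapid_smallCuspForm χ hp hn
  have hg := isRapid_frickeTransform χ hp hn
  have ht' : 0 < (p * q ^ 2 * t)⁻¹ := by positivity
  have hτ := gaussSum_inv_ne_zero hψ
  have hττ := gaussSum_mul_gaussSum_inv_of_isPrimitive hψ
  have h1 := hf.gaussSum_mul_twistRay hψ ht'
  have h2 := hg.gaussSum_mul_twistRay hψ.inv ht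
  rw [sum_dirichletCharacter_mul] at h1 h2
  rw [inv_inv] at h2
  let P : (ZMod q)ˣ := ZMod.unitOfCoprime p hqp.symm
  -- the substitution `u ↦ v` in the sum over residues
  have hinv : Function.Involutive fun u : (ZMod q)ˣ => -(P * u)⁻¹ := fun u => by
    change -(P * -(P * u)⁻¹)⁻¹ = u
    rw [mul_neg, inv_neg, neg_neg, mul_inv_rev, inv_inv, mul_inv_cancel_comm]
  have hkey (u : (ZMod q)ˣ) :
      ψ⁻¹ u * lineFun (smallCuspForm χ n) ((((u : ZMod q).val : ℤ) : ℝ) / q)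
        ((p * q ^ 2 * t)⁻¹) =
      ψ (-1) * ψ p * (χ (q : ZMod p) * (q * (Complex.I * t)) ^ (12 + 2 * n) * (p : ℂ) ^ (6 + n)) *
        (ψ ((-(P * u)⁻¹ : (ZMod q)ˣ) : ZMod q) *
          lineFun (frickeTransform χ n (p := p) hp0)
            (((((-(P * u)⁻¹ : (ZMod q)ˣ) : ZMod q).val : ℤ) : ℝ) / q) t) := by
    set v : (ZMod q)ˣ := -(P * u)⁻¹ with hv
    have huv : (u : ZMod q) * v = -((P⁻¹ : (ZMod q)ˣ) : ZMod q) := by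
      rw [← Units.val_mul, ← Units.val_neg, hv, mul_neg, mul_inv_rev, mul_inv_cancel_left]
    have hdvd : (q : ℤ) ∣ p * ((u : ZMod q).val : ℤ) * ((v : ZMod q).val : ℤ) + 1 := by
      rw [← ZMod.intCast_zmod_eq_zero_iff_dvd]
      push_cast
      rw [ZMod.natCast_zmod_val, ZMod.natCast_zmod_val, mul_assoc, huv,
        show (p : ZMod q) = (P : ZMod q) from rfl, mul_neg, Units.mul_inv, neg_add_cancel]
    have hψuv : ψ⁻¹ (u : ZMod q) = ψ (-1) * ψ p * ψ (v : ZMod q) := by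
      rw [MulChar.inv_apply, Ring.inverse_unit, ← map_mul, ← map_mul]
      congr 1
      rw [show (p : ZMod q) = (P : ZMod q) from rfl, hv]
      rw [← Units.val_one, ← Units.val_neg, ← Units.val_mul, ← Units.val_mul]
      congr 1
      rw [mul_inv]; simp
    have hrel := smallCuspForm_twist_relation χ (n := n) hp hq0 hq hdvd
      (ofComplex ((0 : ℝ) + t * Complex.I))
      (ofComplex (((((u : ZMod q).val : ℤ) : ℝ) / q : ℝ) + ((p * q ^ 2 * t)⁻¹ : ℝ) * Complex.I))
      (ofComplex (((((v : ZMod q).val : ℤ) : ℝ) / q : ℝ) + t * Complex.I))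
      (by
        rw [ofComplex_re_im ht', ofComplex_re_im ht]
        have : (t : ℂ) ≠ 0 := Complex.ofReal_ne_zero.2 ht.ne'
        push_cast
        field_simp
        linear_combination (t : ℂ) * Complex.I_sq)
      (by
        rw [ofComplex_re_im ht, ofComplex_re_im ht]
        push_cast; ring)
    rw [ofComplex_re_im ht] at hrel
    rw [lineFun, lineFun, hrel, hψuv]
    push_cast
    ring
  have hsum := Equiv.sum_comp hinv.toPerm fun v : (ZMod q)ˣ => ψ (v : ZMod q) *
    lineFun (frickeTransform χ n (p := p) hp0) ((((v : ZMod q).val : ℤ) : ℝ) / q) t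
  simp only [Function.Involutive.coe_toPerm] at hsum
  rw [Finset.sum_congr rfl fun u _ => hkey u, ← Finset.mul_sum, hsum, ← h2] at h1
  have h3 : gaussSum ψ⁻¹ (stdAddChar (N := q)) *
      (gaussSum ψ (stdAddChar (N := q)) ^ 2 / q) = ψ (-1) * gaussSum ψ (stdAddChar (N := q)) := by
    field_simp
    linear_combination gaussSum ψ (stdAddChar (N := q)) * hττ
  refine mul_left_cancel₀ hτ (h1.trans ?_)
  rw [mul_pow, mul_pow]
  linear_combination (-Complex.I ^ (12 + 2 * n) * χ (q : ZMod p) * ψ (p : ZMod q) *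
     q ^ (12 + 2 * n) * p ^ (6 + n) *
          ((t : ℂ) ^ (12 + 2 * n) * twistRay (frickeTransform χ n (p := p) hp0) ψ⁻¹ t)) * h3

/-- An inversion `t ↦ 1 / (N t)` of the ray becomes a reflection of the Mellin variable. -/
lemma mellin_of_inversion {F G : ℝ → ℂ} {N : ℝ} (hN : 0 < N) {k : ℕ} {c : ℂ}
    (h : ∀ t : ℝ, 0 < t → F ((N * t)⁻¹) = c * ((t : ℂ) ^ k * G t)) (s : ℂ) :
    mellin F s = c * (N : ℂ) ^ (-s) * mellin G (k - s) := by
  have h1 : mellin (fun t => F ((N * t)⁻¹)) (-s) = c * mellin G (k - s) := by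
    have : mellin (fun t => F ((N * t)⁻¹)) (-s) =
        mellin (fun t => c • ((t : ℂ) ^ (k : ℂ) • G t)) (-s) := by
      refine setIntegral_congr_fun measurableSet_Ioi fun t ht => ?_
      simp only [h t ht, smul_eq_mul, Complex.cpow_natCast]
    rw [this, mellin_const_smul, mellin_cpow_smul, smul_eq_mul, neg_add_eq_sub]
  rw [mellin_comp_mul_left (fun t => F t⁻¹) _ hN, mellin_comp_inv, neg_neg, smul_eq_mul] at h1
  rw [mul_right_comm, ← h1, mul_right_comm, ← Complex.cpow_add _ _ (by exact_mod_cast hN.ne')]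
  simp

theorem mellin_twistRay_smallCuspForm [NeZero q] (hp : 27 ≤ p) (hn : 2 ≤ n) (hp0 : 0 < p)
    (hψ : ψ.IsPrimitive) (hqp : q.Coprime p) (hq : 3 * (q : ℤ) ^ 2 ≤ p - 24) (s : ℂ) :
    mellin (twistRay (smallCuspForm χ n) ψ) s =
      Complex.I ^ (12 + 2 * n) * χ (q : ZMod p) * ψ (p : ZMod q) *
        (gaussSum ψ (stdAddChar (N := q)) ^ 2 / q) *
          ((p : ℂ) * (q : ℂ) ^ 2) ^ (((12 + 2 * n : ℕ) : ℂ) / 2 - s) *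
            mellin (twistRay (frickeTransform χ n (p := p) hp0) ψ⁻¹) ((12 + 2 * n : ℕ) - s) := by
  have hq0 : 0 < q := NeZero.pos q
  have hN : (0 : ℝ) < p * q ^ 2 := by positivity
  rw [mellin_of_inversion hN (fun t ht => twistRay_smallCuspForm hp hn hp0 hψ hqp hq ht) s]
  have hN0 : ((p : ℂ) * (q : ℂ) ^ 2) ≠ 0 := by exact_mod_cast hN.ne'
  have h1 : ((p : ℂ) * (q : ℂ) ^ 2) ^ (((12 + 2 * n : ℕ) : ℂ) / 2 - s) =
      q ^ (12 + 2 * n) * p ^ (6 + n) * (((p * q ^ 2 : ℝ)) : ℂ) ^ (-s) := by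
    rw [show ((12 + 2 * n : ℕ) : ℂ) / 2 - s = ((6 + n : ℕ) : ℂ) + -s by push_cast; ring,
      Complex.cpow_add _ _ hN0, Complex.cpow_natCast, mul_pow, ← pow_mul]
    push_cast
    ring
  rw [h1]
  ring

end FunctionalEquation

theorem theorem1 (p : ℕ) (hp : p.Prime) (hp29 : 29 ≤ p)
    (χ : DirichletCharacter ℂ p) (hχ : χ.Even)
    (k : ℕ) (hk16 : 16 ≤ k) (hk : Even k) :
    ∃ (a b : ℕ → ℂ) (σ : ℝ), 0 < σ ∧
      (a =O[Filter.atTop] fun m : ℕ => (m : ℝ) ^ σ) ∧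
      (b =O[Filter.atTop] fun m : ℕ => (m : ℝ) ^ σ) ∧
      ¬ IsClassicalCuspForm (qSeries a) ∧
      ¬ IsClassicalCuspForm (qSeries b) ∧
      ∃ Λf Λg : (q : ℕ) → DirichletCharacter ℂ q → ℂ → ℂ,
        ∀ (q : ℕ) [NeZero q] (ψ : DirichletCharacter ℂ q), ψ.IsPrimitive → q.Coprime p →
          IsEntireContinuation (Λf q ψ) (twistedLambda a ψ) (σ + 1) ∧
          BoundedInVerticalStrips (Λf q ψ) ∧
          IsEntireContinuation (Λg q ψ) (twistedLambda b ψ) (σ + 1) ∧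
          BoundedInVerticalStrips (Λg q ψ) ∧
          ((q : ℝ) ≤ √(((p : ℝ) - 24) / 3) → ∀ s : ℂ,
            Λf q ψ s =
              Complex.I ^ k * χ (q : ZMod p) * ψ (p : ZMod q) *
                (gaussSum ψ (ZMod.stdAddChar (N := q)) ^ 2 / (q : ℂ)) *
                ((p : ℂ) * (q : ℂ) ^ 2) ^ ((k : ℂ) / 2 - s) * Λg q ψ⁻¹ ((k : ℂ) - s)) := by
  obtain ⟨n, hn, rfl⟩ : ∃ n, 2 ≤ n ∧ k = 12 + 2 * n := by
    obtain ⟨j, rfl⟩ := hk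
    exact ⟨j - 6, by omega, by omega⟩
  have hp27 : 27 ≤ p := by omega
  have hp0 : 0 < p := by omega
  have hf := isRapid_smallCuspForm χ hp27 hn
  have hg := isRapid_frickeTransform χ hp27 hn
  obtain ⟨C, A, hC, hCA⟩ := hf.exists_qCoeff_bound
  obtain ⟨D, B, hD, hDB⟩ := hg.exists_qCoeff_bound
  have hbound {h : ℍ → ℂ} {C : ℝ} {A : ℕ} (hC : 0 < C) (E : ℕ) (hE : A ≤ E)
      (hCA : ∀ m : ℕ, 0 < m → ‖qCoeff h m‖ ≤ C * (m : ℝ) ^ A) :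
      ∀ m : ℕ, 0 < m → ‖qCoeff h m‖ ≤ C * (m : ℝ) ^ E := fun m hm =>
    (hCA m hm).trans (by gcongr; exact_mod_cast hm)
  -- a common exponent for both coefficient sequences, which has to be positive
  have hCA := hbound hC (max A B + 1) (by omega) hCA
  have hDB := hbound hD (max A B + 1) (by omega) hDB
  have hO {h : ℍ → ℂ} {C : ℝ} {E : ℕ}
      (hCA : ∀ m : ℕ, 0 < m → ‖qCoeff h m‖ ≤ C * (m : ℝ) ^ E) :
      qCoeff h =O[Filter.atTop] fun m : ℕ => (m : ℝ) ^ (E : ℝ) := by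
    refine Asymptotics.IsBigO.of_bound C ?_
    filter_upwards [Filter.eventually_gt_atTop 0] with m hm
    rw [Real.rpow_natCast, Real.norm_of_nonneg (by positivity)]
    exact hCA m hm
  refine ⟨qCoeff (smallCuspForm χ n), qCoeff (frickeTransform χ n (p := p) hp0),
    ((max A B + 1 : ℕ) : ℝ), by positivity, hO hCA, hO hDB, ?_, ?_,
    fun q ψ => mellin (twistRay (smallCuspForm χ n) ψ),
    fun q ψ => mellin (twistRay (frickeTransform χ n (p := p) hp0) ψ),
    fun q _ ψ hψ hqp => ?_⟩
  · rw [hf.qSeries_qCoeff]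
    exact not_isClassicalCuspForm_smallCuspForm χ hp hχ hp27 hn
  · rw [hg.qSeries_qCoeff]
    exact not_isClassicalCuspForm_frickeTransform χ hp hχ hp27 hn
  · have hF := hf.isRapidOnRay_twistRay hψ hqp
    have hG := hg.isRapidOnRay_twistRay hψ hqp
    refine ⟨⟨hF.differentiable_mellin, fun s hs => hf.mellin_twistRay hψ hCA hs⟩,
      hF.boundedInVerticalStrips_mellin,
      ⟨hG.differentiable_mellin, fun s hs => hg.mellin_twistRay hψ hDB hs⟩,
      hG.boundedInVerticalStrips_mellin, fun hq s => ?_⟩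
    refine mellin_twistRay_smallCuspForm hp27 hn hp0 hψ hqp ?_ s
    have hp' : (29 : ℝ) ≤ p := by exact_mod_cast hp29
    have h1 := (Real.le_sqrt' (by exact_mod_cast NeZero.pos q)).1 hq
    have h2 : 3 * (q : ℝ) ^ 2 ≤ p - 24 := by linarith
    exact_mod_cast h2

end
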